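/- Let $V$ be a finite-dimensional real vector space with a lattice $\Gamma$ of full rank, and let $\Phi=[\beta_1,\ldots,\beta_N]$ be a sequence of (not necessarily distinct) elements of the dual lattice $\Gamma^*\subset V^*$ that spans $V^*$. Put $\rho(x)=\sum_{i=1}^N x_i\beta_i$ for $x\in\mathbb R^N$, and assume that $\rho(x)=0$ with $x\in\mathbb R_{\ge 0}^N$ only for $x=0$. Let $C(\Phi)=\rho(\mathbb R_{\ge0}^N)$ be the cone generated by $\Phi$ and let $\mathbb Z\Phi\subset\Gamma^*$ be the lattice generated by $\Phi$. For $a\in V^*$ let $\Pi_\Phi(a)=\{x\in\mathbb R_{\ge 0}^N:\rho(x)=a\}$ be the partition polytope, and let $\iota_\Phi(a)=\#(\Pi_\Phi(a)\cap\mathbb Z^N)$. Let $\lambda\in C(\Phi)\cap\mathbb Z\Phi$ and $E[\lambda](k)=\iota_\Phi(k\lambda)$ for integers $k\ge0$. Let $M$ be a positive integer such that the polytope $M\,\Pi_\Phi(\lambda)$ is integral, i.e. all its vertices lie in $\mathbb Z^N$. Then there are polynomials $P_\zeta\in\mathbb C[t]$, indexed by the complex $M$th roots of unity $\zeta$, such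 that $$E[\lambda](k)=\sum_{\zeta^M=1}\zeta^k P_\zeta(k)\qquad\text{for all integers } k\ge 0.$$ Furthermore, let $j\ge0$ be an integer such that every $j$-dimensional face $f$ of $\Pi_\Phi(\lambda)$ is reticular, i.e. the affine space spanned by $f$ contains a point of $\mathbb Z^N$. Then for every $\zeta\ne1$ with $\zeta^M=1$ the polynomial $P_\zeta$ has degree strictly less than $j$, where the zero polynomial is given degree $-1$. -/

import Mathlib

open scoped Pointwise

noncomputable section

namespace PartitionPolytope

/-- The dual lattice `Γ* ⊆ V*`: the linear forms taking integer values on `Γ`. -/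
def dualLattice {V : Type*} [NormedAddCommGroup V] [NormedSpace ℝ V] (Γ : Submodule ℤ V) :
    Set (Module.Dual ℝ V) :=
  {f | ∀ v ∈ Γ, ∃ m : ℤ, f v = m}

/-- The linear map `ρ : ℝ^N → V*`, `ρ(x) = ∑ xᵢ βᵢ`, attached to `Φ = [β₁, …, β_N]`. -/
def rho {V : Type*} [NormedAddCommGroup V] [NormedSpace ℝ V] {N : ℕ}
    (Φ : Fin N → Module.Dual ℝ V) : (Fin N → ℝ) →ₗ[ℝ] Module.Dual ℝ V :=
  Fintype.linearCombination ℝ Φ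

/-- The closed cone `C_N^+` generated by the standard basis of `ℝ^N`. -/
def orthant (N : ℕ) : Set (Fin N → ℝ) := {x | ∀ i, 0 ≤ x i}

/-- The cone `C(Φ) = ρ(C_N^+)` generated by `Φ`. -/
def cone {V : Type*} [NormedAddCommGroup V] [NormedSpace ℝ V] {N : ℕ}
    (Φ : Fin N → Module.Dual ℝ V) : Set (Module.Dual ℝ V) :=
  rho Φ '' orthant N

/-- The partition polytope `Π_Φ(a) = ρ⁻¹(a) ∩ C_N^+`. -/
def polytope {V : Type*} [NormedAddCommGroup V] [NormedSpace ℝ V] {N : ℕ}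
    (Φ : Fin N → Module.Dual ℝ V) (a : Module.Dual ℝ V) : Set (Fin N → ℝ) :=
  rho Φ ⁻¹' {a} ∩ orthant N

/-- The standard lattice `ℤ^N` in `ℝ^N`. -/
def stdLattice (N : ℕ) : Set (Fin N → ℝ) := {x | ∀ i, ∃ m : ℤ, x i = m}

/-- The vector partition function `ι_Φ(a)`: the number of points of `Π_Φ(a)` with integral
coordinates (this set is finite under the standing assumption on `Φ`, see
`finite_latticePoints`). -/
def vectorPartition {V : Type*} [NormedAddCommGroup V] [NormedSpace ℝ V] {N : ℕ}
    (Φ : Fin N → Module.Dual ℝ V) (a : Module.Dual ℝ V) : ℕ :=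
  (polytope Φ a ∩ stdLattice N).ncard

/-- The Ehrhart function `E[a](k) = ι_Φ(k a)`. -/
def ehrhart {V : Type*} [NormedAddCommGroup V] [NormedSpace ℝ V] {N : ℕ}
    (Φ : Fin N → Module.Dual ℝ V) (a : Module.Dual ℝ V) (k : ℕ) : ℕ :=
  vectorPartition Φ ((k : ℝ) • a)

/-- `f` is a `j`-dimensional (nonempty) face of the convex polytope `P`: a nonempty set of
maximizers on `P` of a linear form (the form `0` gives `P` itself), with affine span of
dimension `j`. -/
def IsFaceOfDim {N : ℕ} (P f : Set (Fin N → ℝ)) (j : ℕ) : Prop :=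
  f.Nonempty ∧ IsExposed ℝ P f ∧ Module.finrank ℝ (affineSpan ℝ f).direction = j

/-- A polytope is integral if all its vertices (faces of dimension `0`) are in the lattice. -/
def IsIntegral {N : ℕ} (P : Set (Fin N → ℝ)) : Prop :=
  ∀ f : Set (Fin N → ℝ), IsFaceOfDim P f 0 → f ⊆ stdLattice N

/-- A face is reticular if the affine space that it spans contains a lattice point. -/
def IsReticular {N : ℕ} (f : Set (Fin N → ℝ)) : Prop :=
  ∃ z ∈ stdLattice N, z ∈ affineSpan ℝ f

/-- Under the standing assumption `ρ⁻¹(0) ∩ C_N^+ = {0}`, the set counted by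
`vectorPartition` is finite. -/
theorem finite_latticePoints {V : Type*} [NormedAddCommGroup V] [NormedSpace ℝ V] {N : ℕ}
    (Φ : Fin N → Module.Dual ℝ V) (hΦ : rho Φ ⁻¹' {0} ∩ orthant N = {0})
    (a : Module.Dual ℝ V) : (polytope Φ a ∩ stdLattice N).Finite := by
  set S : Set (Fin N → ℕ) := {n | rho Φ (fun i => (n i : ℝ)) = a} with hS
  have hanti : IsAntichain (· ≤ ·) S := by
    intro n hn m hm hne hle
    apply hne
    have h0 : (fun i => ((m i : ℝ) - n i)) ∈ rho Φ ⁻¹' {0} ∩ orthant N := by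
      refine ⟨?_, fun i => ?_⟩
      · have h1 : (fun i => ((m i : ℝ) - n i)) = (fun i => (m i : ℝ)) - fun i => (n i : ℝ) := rfl
        simp only [Set.mem_preimage, Set.mem_singleton_iff, h1, map_sub]
        rw [show rho Φ (fun i => (m i : ℝ)) = a from hm,
          show rho Φ (fun i => (n i : ℝ)) = a from hn, sub_self]
      · exact sub_nonneg.2 (by exact_mod_cast hle i)
    rw [hΦ] at h0
    funext i
    have h2 := congrFun h0 i
    simp only [Pi.zero_apply] at h2
    have h3 : (m i : ℝ) = n i := by linarith
    exact_mod_cast h3.symm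
  have hfin : S.Finite :=
    hanti.finite_of_partiallyWellOrderedOn (Set.isPWO_of_wellQuasiOrderedLE S)
  refine (hfin.image (fun n i => (n i : ℝ))).subset ?_
  rintro x ⟨⟨hx, hpos⟩, hint⟩
  choose m hm using hint
  refine ⟨fun i => (m i).toNat, ?_, ?_⟩
  all_goals
    have hx' : (fun i => (((m i).toNat : ℕ) : ℝ)) = x := by
      funext i
      have h1 : (0 : ℝ) ≤ m i := hm i ▸ hpos i
      have h2 : (0 : ℤ) ≤ m i := by exact_mod_cast h1
      rw [hm i]
      exact_mod_cast Int.toNat_of_nonneg h2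
  · exact (congrArg (rho Φ) hx').trans hx
  · exact hx'

end PartitionPolytope

end

/-! Homogenize: the pairs `(x, t)` with `ρ(x) = t λ` form a subspace `W`, and `k Π_Φ(λ)` is the
slice at height `t = k` of the cone `W ∩ orthant`. So `∑ E[λ](k) X^k` counts lattice points of a
cone by height. More general series are needed: a face `x_I = 0` of the cone, translated by a vector
`y`. Everything is proved by induction on the number of coordinates outside `I`.

Integrality of `M Π_Φ(λ)` gives each nonzero face a lattice vector `w` of height `M`. Translating by
`w` multiplies a series by `X^M`, and the points lost when `y` slides to `y + w` lie on smaller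
faces translated by `y + τ w`, `0 ≤ τ < 1`. Hence the series is `p / (1 - X^M)^r`, and the bound `τ
< 1` keeps the degree of `p` below `M r` when `y = 0` (`sliceSeries_mem_properSubmodule`). A proper
fraction has no polynomial part, so partial fractions give the formula for every `k ≥ 0`, and `deg
P_ζ` is less than the pole order at `ζ⁻¹` (`exists_quasiPolynomial`).

For the degree bound, a reticular face of dimension `j` gives a lattice vector `z` of height `1` in
the span of a cone face of dimension `j + 1`. Translating by `z` gives a factor `1 - X` instead of
`1 - X^M`, invertible at `ζ ≠ 1`, so the pole order does not grow beyond `j`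
(`poleLE_sliceSeries_of_reticular`). Faces of dimension at most `j` are covered by
`poleLE_sliceSeries_finrank`. -/

namespace PartitionPolytope

open Polynomial

/-! ### Rational power series and partial fractions -/

/-- The power series `F` is a rational function with a pole of order at most `j` at `a`. -/
def PoleLE (a : ℂ) (j : ℕ) (F : PowerSeries ℂ) : Prop :=
  ∃ G Q : ℂ[X], G.eval a ≠ 0 ∧ (((X - C a) ^ j * G : ℂ[X]) : PowerSeries ℂ) * F = Q

theorem exists_polynomial_eval_choose (m : ℕ) :
    ∃ Q : ℂ[X], Q.natDegree ≤ m ∧ ∀ k : ℕ, Q.eval (k : ℂ) = ((m + k).choose m : ℕ) := by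
  -- The binomial coefficient is `(k + 1) ⋯ (k + m) / m!`.
  refine ⟨C ((m.factorial : ℂ)⁻¹) * (ascPochhammer ℂ m).comp (X + 1), ?_, fun k => ?_⟩
  · refine (natDegree_C_mul_le _ _).trans (natDegree_comp_le.trans ?_)
    rw [ascPochhammer_natDegree]
    have : (X + 1 : ℂ[X]).natDegree = 1 := natDegree_X_add_C 1
    rw [this, mul_one]
  · have h : (ascPochhammer ℂ m).eval ((k : ℂ) + 1) = ((k + 1).ascFactorial m : ℕ) := by
      rw [← ascPochhammer_nat_eq_ascFactorial]
      have := ascPochhammer_eval_cast (S := ℂ) m (k + 1)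
      push_cast at this ⊢
      rw [this]
    simp only [eval_mul, eval_C, eval_comp, eval_add, eval_X, eval_one]
    rw [h, Nat.ascFactorial_eq_factorial_mul_choose, Nat.cast_mul, ← mul_assoc,
      inv_mul_cancel₀ (by exact_mod_cast m.factorial_ne_zero), one_mul, add_comm k m]

/-- The expansion of `1 / (1 - ζ X) ^ (m + 1)`. -/
theorem exists_inverse_pow (ζ : ℂ) (hζ : ζ ≠ 0) (m : ℕ) (c : ℂ) :
    ∃ Q : ℂ[X], Q.natDegree ≤ m ∧
      (PowerSeries.mk fun k => ζ ^ k * Q.eval (k : ℂ)) *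
        (((X - C ζ⁻¹) ^ (m + 1) : ℂ[X]) : PowerSeries ℂ) = ((C c : ℂ[X]) : PowerSeries ℂ) := by
  obtain ⟨Q, hQ, hQe⟩ := exists_polynomial_eval_choose m
  refine ⟨C (c * (-ζ) ^ (m + 1)) * Q, (natDegree_C_mul_le _ _).trans hQ, ?_⟩
  have h1 := congrArg (PowerSeries.rescale ζ)
    (PowerSeries.mk_add_choose_mul_one_sub_pow_eq_one ℂ m)
  simp only [map_mul, map_pow, map_sub, map_one, PowerSeries.rescale_mk,
    PowerSeries.rescale_X] at h1
  have h2 : (PowerSeries.mk fun k : ℕ => ζ ^ k * (C (c * (-ζ) ^ (m + 1)) * Q).eval (k : ℂ)) =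
      PowerSeries.C (c * (-ζ) ^ (m + 1)) *
        PowerSeries.mk fun k : ℕ => ζ ^ k * (((m + k).choose m : ℕ) : ℂ) := by
    ext k
    simp only [PowerSeries.coeff_mk, PowerSeries.coeff_C_mul, eval_mul, eval_C, hQe]
    ring
  have h3 : (1 - PowerSeries.C ζ * PowerSeries.X : PowerSeries ℂ) =
      PowerSeries.C (-ζ) * ((X - C ζ⁻¹ : ℂ[X]) : PowerSeries ℂ) := by
    rw [Polynomial.coe_sub, Polynomial.coe_X, Polynomial.coe_C, mul_sub, ← map_mul]
    rw [neg_mul, mul_inv_cancel₀ hζ, map_neg, map_neg, map_one]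
    ring
  rw [h3, mul_pow, ← map_pow] at h1
  rw [h2, map_mul, Polynomial.coe_pow, Polynomial.coe_C]
  calc _ = PowerSeries.C c * (PowerSeries.mk (fun k : ℕ => ζ ^ k * (((m + k).choose m : ℕ) : ℂ)) *
        (PowerSeries.C ((-ζ) ^ (m + 1)) * ((X - C ζ⁻¹ : ℂ[X]) : PowerSeries ℂ) ^ (m + 1))) := by ring
    _ = _ := by
      rw [show (PowerSeries.mk (fun k : ℕ => ζ ^ k * (((m + k).choose m : ℕ) : ℂ))) =
        PowerSeries.mk ((fun k => ζ ^ k) * fun k => (((m + k).choose m : ℕ) : ℂ)) from rfl]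
      first
        | rw [h1, mul_one]
        | (erw [h1]; rw [mul_one])

/-- The polynomials `H` such that `H * F` is a polynomial. -/
def denominators (F : PowerSeries ℂ) : Ideal ℂ[X] where
  carrier := {H | ∃ Q : ℂ[X], (H : PowerSeries ℂ) * F = Q}
  add_mem' := by
    rintro a b ⟨Q, hQ⟩ ⟨R, hR⟩
    exact ⟨Q + R, by rw [coe_add, coe_add, add_mul, hQ, hR]⟩
  zero_mem' := ⟨0, by simp⟩
  smul_mem' := by
    rintro c a ⟨Q, hQ⟩
    exact ⟨c * Q, by rw [smul_eq_mul, coe_mul, coe_mul, mul_assoc, hQ]⟩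

/-- The denominators of `F` form a principal ideal. Its generator divides `(1 - X^M)^r`, so its
roots are `M`th roots of unity, and its multiplicity at a point is at most any pole order allowed
there. Writing the roots as `ζ⁻¹` matches the expansion of `1 / (1 - ζ X)`. -/
theorem exists_reduced_denominator (M : ℕ) (F : PowerSeries ℂ) (r : ℕ) (p : ℂ[X])
    (h : F * (1 - PowerSeries.X ^ M) ^ r = (p : PowerSeries ℂ)) (hM : 0 < M) (hp : p.degree < (M * r : ℕ)) :
    ∃ e : ℂ → ℕ, ∃ p₀ : ℂ[X],
      ((∏ ζ ∈ nthRootsFinset M (1 : ℂ), (X - C ζ⁻¹) ^ e ζ : ℂ[X]) : PowerSeries ℂ) * F = p₀ ∧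
      p₀.degree < (∏ ζ ∈ nthRootsFinset M (1 : ℂ), (X - C ζ⁻¹) ^ e ζ : ℂ[X]).degree ∧
      ∀ j ζ, PoleLE ζ⁻¹ j F → e ζ ≤ j := by
  classical
  set B : ℂ[X] := (1 - X ^ M) ^ r with hB
  have hBF : (B : PowerSeries ℂ) * F = p := by
    rw [← h, hB, mul_comm]; simp
  have hM1 : (1 - X ^ M : ℂ[X]) = -(X ^ M - C 1) := by simp
  have hB0 : B ≠ 0 := pow_ne_zero _ (by rw [hM1]; exact neg_ne_zero.2 (X_pow_sub_C_ne_zero hM 1))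
  have hBdeg : B.degree = (M * r : ℕ) := by
    rw [hB, degree_pow, hM1, degree_neg, degree_X_pow_sub_C hM, mul_comm, nsmul_eq_mul]
    push_cast; rfl
  obtain ⟨H, hH⟩ := IsPrincipalIdealRing.principal (denominators F)
  have hdiv : ∀ G : ℂ[X], G ∈ denominators F ↔ H ∣ G := fun G => by
    rw [hH]; exact Ideal.mem_span_singleton
  obtain ⟨S, hS⟩ := (hdiv B).1 ⟨p, hBF⟩
  have hH0 : H ≠ 0 := by rintro rfl; exact hB0 (by rw [hS, zero_mul])
  have hS0 : S ≠ 0 := by rintro rfl; exact hB0 (by rw [hS, mul_zero])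
  have hroots : ∀ a ∈ H.roots, a ^ M = 1 := fun a ha => by
    have h1 : H.eval a = 0 := (mem_roots hH0).1 ha
    have h2 : B.eval a = 0 := by rw [hS, eval_mul, h1, zero_mul]
    rw [hB, eval_pow] at h2
    have h3 := eq_zero_of_pow_eq_zero h2
    simp only [eval_sub, eval_one, eval_pow, eval_X] at h3
    exact (sub_eq_zero.1 h3).symm
  have hprod : C H.leadingCoeff *
      ∏ ζ ∈ nthRootsFinset M (1 : ℂ), (X - C ζ⁻¹) ^ H.rootMultiplicity ζ⁻¹ = H := by
    have h1 := (IsAlgClosed.splits H).eq_prod_roots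
    conv_rhs => rw [h1]
    congr 1
    rw [Finset.prod_multiset_map_count]
    rw [← Finset.prod_image (s := nthRootsFinset M (1 : ℂ)) (g := fun ζ => ζ⁻¹)
      (f := fun a => (X - C a) ^ H.rootMultiplicity a) (fun a _ b _ hab => inv_injective hab)]
    symm
    simp only [count_roots]
    refine Finset.prod_subset (fun a ha => ?_) fun a _ ha => ?_
    · refine Finset.mem_image.2 ⟨a⁻¹, ?_, inv_inv a⟩
      rw [mem_nthRootsFinset hM, inv_pow, hroots a (Multiset.mem_toFinset.1 ha), inv_one]
    · have : H.rootMultiplicity a = 0 := by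
        rw [← count_roots, Multiset.count_eq_zero]
        exact fun hh => ha (Multiset.mem_toFinset.2 hh)
      rw [this, pow_zero]
  set D : ℂ[X] := ∏ ζ ∈ nthRootsFinset M (1 : ℂ), (X - C ζ⁻¹) ^ H.rootMultiplicity ζ⁻¹ with hD
  have hlc : H.leadingCoeff ≠ 0 := leadingCoeff_ne_zero.2 hH0
  have hDH : H ∣ D := by
    refine ⟨C H.leadingCoeff⁻¹, ?_⟩
    rw [show H * C H.leadingCoeff⁻¹ = C H.leadingCoeff * D * C H.leadingCoeff⁻¹ by rw [hprod]]
    rw [mul_right_comm, ← C_mul, mul_inv_cancel₀ hlc, C_1, one_mul]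
  obtain ⟨p₀, hp₀⟩ := (hdiv D).2 hDH
  refine ⟨fun ζ => H.rootMultiplicity ζ⁻¹, p₀, hp₀, ?_, ?_⟩
  -- Both `B` and `p` carry the same extra factor over `D` and `p₀`; cancelling it transfers
  -- properness to the reduced fraction.
  · have hBD : B = D * (C H.leadingCoeff * S) := by rw [hS]; nth_rw 1 [← hprod]; ring
    have hpp : p = p₀ * (C H.leadingCoeff * S) := by
      apply Polynomial.coe_injective
      rw [← hBF, hBD, coe_mul, coe_mul p₀, ← hp₀]; ring
    have hc0 : C H.leadingCoeff * S ≠ 0 := mul_ne_zero (C_ne_zero.2 hlc) hS0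
    rw [← hBdeg, hpp, hBD, degree_mul, degree_mul (p := D)] at hp
    exact lt_of_add_lt_add_right hp
  · rintro j ζ ⟨G, Q, hG, hQ⟩
    have h1 : H ∣ (X - C ζ⁻¹) ^ j * G := (hdiv _).1 ⟨Q, hQ⟩
    have hG0 : G ≠ 0 := by rintro rfl; simp at hG
    have h0 : (X - C ζ⁻¹) ^ j * G ≠ 0 := mul_ne_zero (pow_ne_zero _ (X_sub_C_ne_zero _)) hG0
    have h2 := rootMultiplicity_le_rootMultiplicity_of_dvd h0 h1 ζ⁻¹
    rw [rootMultiplicity_mul h0, rootMultiplicity_X_sub_C_pow,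
      rootMultiplicity_eq_zero hG, add_zero] at h2
    exact h2

/-- Decompose over the reduced denominator: a term `c / (X - ζ⁻¹)^(m+1)` has coefficients `ζ^k Q(k)`
with `deg Q ≤ m`, and `m + 1` never exceeds the true pole order. One family `P` thus serves all `j`
at once. -/
theorem exists_quasiPolynomial (M : ℕ) (hM : 0 < M) (F : PowerSeries ℂ) (r : ℕ) (p : ℂ[X])
    (h : F * (1 - PowerSeries.X ^ M) ^ r = (p : PowerSeries ℂ)) (hp : p.degree < (M * r : ℕ)) :
    ∃ P : ℂ → ℂ[X],
      (∀ k : ℕ, PowerSeries.coeff k F =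
        ∑ ζ ∈ nthRootsFinset M (1 : ℂ), ζ ^ k * (P ζ).eval (k : ℂ)) ∧
      ∀ j ζ, ζ ^ M = 1 → PoleLE ζ⁻¹ j F → (P ζ).degree < (j : WithBot ℕ) := by
  classical
  obtain ⟨e, p₀, hF, hdeg, he⟩ := exists_reduced_denominator M F r p h hM hp
  set s := nthRootsFinset M (1 : ℂ) with hs
  set D : ℂ[X] := ∏ ζ ∈ s, (X - C ζ⁻¹) ^ e ζ with hD
  have hζ0 : ∀ ζ : ℂ, ζ ^ M = 1 → ζ ≠ 0 := by
    rintro ζ h1 rfl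
    rw [zero_pow hM.ne'] at h1; exact zero_ne_one h1
  have hmon : ∀ ζ ∈ s, (X - C ζ⁻¹ : ℂ[X]).Monic := fun ζ _ => monic_X_sub_C _
  have hDmon : D.Monic := monic_prod_of_monic _ _ fun ζ hζ => (hmon ζ hζ).pow _
  obtain ⟨q, R, hR, hpf⟩ := eq_quo_mul_prod_pow_add_sum_rem_mul_prod_pow p₀ hmon
    (fun ζ _ ξ _ hne => isCoprime_X_sub_C_of_isUnit_sub
      (sub_ne_zero.2 (inv_injective.ne hne)).isUnit) e
  have hR' : ∀ ζ ∈ s, ∀ j, R ζ j = C ((R ζ j).coeff 0) := fun ζ hζ j => by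
    apply eq_C_of_degree_le_zero
    have := hR ζ hζ j
    rw [degree_X_sub_C] at this
    exact Order.le_of_lt_succ this
  -- The partial fraction terms, brought over `D`, have degree less than `deg D`, as does `p₀`; a
  -- nonzero `q * D` would not.
  have hq : q = 0 := by
    by_contra hq0
    have h1 : (p₀ - ∑ ζ ∈ s, ∑ j, R ζ j * (X - C ζ⁻¹) ^ j.1 *
        ∏ k ∈ s.erase ζ, (X - C k⁻¹) ^ e k).degree < D.degree := by
      refine (degree_sub_le _ _).trans_lt (max_lt hdeg ?_)
      refine (degree_sum_le _ _).trans_lt ((Finset.sup_lt_iff ?_).2 fun ζ hζ => ?_)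
      · exact bot_lt_iff_ne_bot.2 (degree_ne_bot.2 hDmon.ne_zero)
      refine (degree_sum_le _ _).trans_lt ((Finset.sup_lt_iff ?_).2 fun j _ => ?_)
      · exact bot_lt_iff_ne_bot.2 (degree_ne_bot.2 hDmon.ne_zero)
      have hEmon : (∏ k ∈ s.erase ζ, (X - C k⁻¹) ^ e k : ℂ[X]).Monic :=
        monic_prod_of_monic _ _ fun k _ => (monic_X_sub_C _).pow _
      rw [hD, ← Finset.mul_prod_erase s _ hζ, hR' ζ hζ j, degree_mul, degree_mul, degree_mul,
        degree_pow, degree_pow, degree_X_sub_C, degree_eq_natDegree hEmon.ne_zero]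
      refine (add_le_add_left (add_le_add_left degree_C_le _) _).trans_lt ?_
      rw [zero_add, nsmul_eq_mul, nsmul_eq_mul, mul_one, mul_one]
      exact_mod_cast Nat.add_lt_add_right j.2 _
    rw [hpf, add_sub_cancel_right, degree_mul] at h1
    have h2 := degree_eq_natDegree hq0
    have h3 := degree_eq_natDegree hDmon.ne_zero
    rw [h2, h3] at h1
    norm_cast at h1
    omega
  rw [hq, zero_mul, zero_add] at hpf
  have hsingle : ∀ ζ : ℂ, ∀ j : Fin (e ζ), ∃ Q : ℂ[X], ζ ∈ s →
      Q.degree < (e ζ : WithBot ℕ) ∧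
      (PowerSeries.mk fun k => ζ ^ k * Q.eval (k : ℂ)) *
        (((X - C ζ⁻¹) ^ (e ζ - j) : ℂ[X]) : PowerSeries ℂ) = (R ζ j : PowerSeries ℂ) := by
    intro ζ j
    by_cases hζ : ζ ∈ s
    · obtain ⟨Q, hQ, hQe⟩ := exists_inverse_pow ζ (hζ0 ζ ((mem_nthRootsFinset hM _).1 hζ))
        (e ζ - j - 1) ((R ζ j).coeff 0)
      have hj := j.2
      refine ⟨Q, fun _ => ⟨?_, ?_⟩⟩
      · refine degree_le_natDegree.trans_lt ?_
        exact_mod_cast (by omega : Q.natDegree < e ζ)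
      · rw [← hR' ζ hζ j, show e ζ - j - 1 + 1 = e ζ - j by omega] at hQe
        exact hQe
    · exact ⟨0, fun h => absurd h hζ⟩
  choose Q hQ using hsingle
  refine ⟨fun ζ => ∑ j, Q ζ j, ?_, fun j ζ hζ hpole => ?_⟩
  · have hFs : F = ∑ ζ ∈ s, ∑ j, PowerSeries.mk fun k => ζ ^ k * (Q ζ j).eval (k : ℂ) := by
      have hD0 : (D : PowerSeries ℂ) ≠ 0 := by
        rw [Ne, Polynomial.coe_eq_zero_iff]; exact hDmon.ne_zero
      apply mul_left_cancel₀ hD0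
      rw [hF, hpf, Finset.mul_sum, ← coeToPowerSeries.ringHom_apply, map_sum]
      refine Finset.sum_congr rfl fun ζ hζ => ?_
      rw [Finset.mul_sum, map_sum]
      refine Finset.sum_congr rfl fun j _ => ?_
      rw [coeToPowerSeries.ringHom_apply, coe_mul, coe_mul, ← (hQ ζ j hζ).2, hD,
        ← Finset.mul_prod_erase s _ hζ,
        show (X - C ζ⁻¹ : ℂ[X]) ^ e ζ = (X - C ζ⁻¹) ^ (e ζ - j) * (X - C ζ⁻¹) ^ (j : ℕ) by
          rw [← pow_add, Nat.sub_add_cancel j.2.le], coe_mul, coe_mul]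
      ring
    intro k
    rw [hFs, map_sum]
    refine Finset.sum_congr rfl fun ζ _ => ?_
    rw [map_sum, eval_finsetSum, Finset.mul_sum]
    exact Finset.sum_congr rfl fun j _ => by rw [PowerSeries.coeff_mk]
  · have hζs : ζ ∈ s := (mem_nthRootsFinset hM _).2 hζ
    refine (degree_sum_le _ _).trans_lt ((Finset.sup_lt_iff (WithBot.bot_lt_coe j)).2 fun i _ => ?_)
    exact (hQ ζ i hζs).1.trans_le (Nat.cast_le.2 (he j ζ hpole))

/-! ### Calculus of pole orders and of proper fractions -/

theorem PoleLE.add {a : ℂ} {j : ℕ} {F F' : PowerSeries ℂ} (h : PoleLE a j F)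
    (h' : PoleLE a j F') : PoleLE a j (F + F') := by
  obtain ⟨G, Q, hG, hQ⟩ := h
  obtain ⟨G', Q', hG', hQ'⟩ := h'
  refine ⟨G * G', G' * Q + G * Q', by rw [eval_mul]; exact mul_ne_zero hG hG', ?_⟩
  simp only [coe_mul, coe_add] at hQ hQ' ⊢
  rw [← hQ, ← hQ']
  ring

theorem PoleLE.polynomial_mul {a : ℂ} {j : ℕ} {F : PowerSeries ℂ} (h : PoleLE a j F)
    (p : ℂ[X]) : PoleLE a j ((p : PowerSeries ℂ) * F) := by
  obtain ⟨G, Q, hG, hQ⟩ := h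
  refine ⟨G, p * Q, hG, ?_⟩
  rw [coe_mul p, ← hQ]
  ring

theorem PoleLE.sub {a : ℂ} {j : ℕ} {F F' : PowerSeries ℂ} (h : PoleLE a j F)
    (h' : PoleLE a j F') : PoleLE a j (F - F') := by
  have := h.add (h'.polynomial_mul (-1))
  rwa [coe_neg, coe_one, neg_one_mul, ← sub_eq_add_neg] at this

theorem PoleLE.mono {a : ℂ} {j j' : ℕ} {F : PowerSeries ℂ} (h : PoleLE a j F) (hj : j ≤ j') :
    PoleLE a j' F := by
  obtain ⟨G, Q, hG, hQ⟩ := h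
  refine ⟨G, (X - C a) ^ (j' - j) * Q, hG, ?_⟩
  rw [coe_mul _ Q, ← hQ, ← Nat.sub_add_cancel hj, pow_add, Nat.add_sub_cancel]
  simp only [coe_mul]
  ring

theorem PoleLE.of_polynomial (a : ℂ) (j : ℕ) (p : ℂ[X]) : PoleLE a j (p : PowerSeries ℂ) :=
  ⟨1, (X - C a) ^ j * p, by simp, by rw [mul_one, coe_mul]⟩

theorem PoleLE.of_mul {a : ℂ} {j : ℕ} {F : PowerSeries ℂ} {p : ℂ[X]} (hp : p.eval a ≠ 0)
    (h : PoleLE a j ((p : PowerSeries ℂ) * F)) : PoleLE a j F := by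
  obtain ⟨G, Q, hG, hQ⟩ := h
  refine ⟨p * G, Q, by rw [eval_mul]; exact mul_ne_zero hp hG, ?_⟩
  rw [← hQ]
  simp only [coe_mul]
  ring

theorem PoleLE.of_one_sub_X_pow_mul {a : ℂ} {j M : ℕ} (hM : 0 < M) (ha : a ^ M = 1)
    {F : PowerSeries ℂ} (h : PoleLE a j ((1 - PowerSeries.X ^ M) * F)) : PoleLE a (j + 1) F := by
  have hroot : (1 - X ^ M : ℂ[X]).eval a = 0 := by simp [ha]
  obtain ⟨g, hg⟩ := dvd_iff_isRoot.2 hroot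
  -- The zero of `1 - X ^ M` at `a` is simple, since its derivative does not vanish there; hence
  -- only one order is lost.
  have hga : g.eval a ≠ 0 := by
    have h1 := congrArg (fun p => (derivative p).eval a) hg
    simp only [derivative_sub, derivative_one, derivative_X_pow, derivative_mul, derivative_X,
      derivative_C, eval_sub, eval_mul, eval_C, eval_X, eval_add, sub_self, zero_mul, add_zero,
      sub_zero, one_mul, zero_sub] at h1
    rw [← h1]
    have ha0 : a ≠ 0 := by rintro rfl; rw [zero_pow hM.ne'] at ha; exact zero_ne_one ha
    rw [eval_neg, eval_mul, eval_C, eval_pow, eval_X]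
    exact neg_ne_zero.2 (mul_ne_zero (Nat.cast_ne_zero.2 hM.ne') (pow_ne_zero _ ha0))
  obtain ⟨G, Q, hG, hQ⟩ := h
  refine ⟨g * G, Q, by rw [eval_mul]; exact mul_ne_zero hga hG, ?_⟩
  have h2 : (1 - PowerSeries.X ^ M : PowerSeries ℂ) = ((1 - X ^ M : ℂ[X]) : PowerSeries ℂ) := by
    simp
  rw [← hQ, h2, hg]
  simp only [coe_mul, coe_pow]
  ring

theorem PoleLE.of_one_sub_X_mul {a : ℂ} {j : ℕ} (ha : a ≠ 1) {F : PowerSeries ℂ}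
    (h : PoleLE a j ((1 - PowerSeries.X) * F)) : PoleLE a j F := by
  refine PoleLE.of_mul (p := 1 - X) (by simpa [sub_eq_zero] using ha.symm) ?_
  rwa [coe_sub, coe_one, coe_X]

/-- Rational functions `p / (1 - X ^ M) ^ r` with `p` of degree less than `M r + b`. -/
def properSubmodule (M : ℕ) (b : ℝ) : Submodule ℂ (PowerSeries ℂ) where
  carrier := {F | ∃ (r : ℕ) (p : ℂ[X]), F * (1 - PowerSeries.X ^ M) ^ r = (p : PowerSeries ℂ) ∧
    ∀ n, p.coeff n ≠ 0 → (n : ℝ) < M * r + b}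
  zero_mem' := ⟨0, 0, by simp, by simp⟩
  smul_mem' := by
    rintro c F ⟨r, p, hp, hc⟩
    refine ⟨r, C c * p, ?_, fun n hn => hc n fun h => hn (by rw [coeff_C_mul, h, mul_zero])⟩
    rw [smul_mul_assoc, hp, coe_mul, coe_C, PowerSeries.smul_eq_C_mul]
  add_mem' := by
    -- Passing to a common denominator raises the numerator degree by at most `M * s`, exactly what
    -- the bound allows.
    have key : ∀ (p : ℂ[X]) (r s : ℕ), (∀ n, p.coeff n ≠ 0 → (n : ℝ) < M * r + b) →
        ∀ n : ℕ, (p * (1 - X ^ M) ^ s).coeff n ≠ 0 → (n : ℝ) < M * (r + s : ℕ) + b := by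
      intro p r s hp n hn
      rw [coeff_mul] at hn
      obtain ⟨⟨x, y⟩, hxy, hne⟩ := Finset.exists_ne_zero_of_sum_ne_zero hn
      have h1 := hp x (left_ne_zero_of_mul hne)
      have h2 : y ≤ s * M := by
        refine (le_natDegree_of_ne_zero (right_ne_zero_of_mul hne)).trans ?_
        refine natDegree_pow_le_of_le s ((natDegree_sub_le _ _).trans ?_)
        simp
      have h3 : (n : ℝ) = x + y := by exact_mod_cast (Finset.HasAntidiagonal.mem_antidiagonal.1 hxy).symm
      have h4 : (y : ℝ) ≤ s * M := by exact_mod_cast h2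
      push_cast
      linarith
    rintro F F' ⟨r, p, hp, hc⟩ ⟨r', p', hp', hc'⟩
    refine ⟨r + r', p * (1 - X ^ M) ^ r' + p' * (1 - X ^ M) ^ r, ?_, fun n hn => ?_⟩
    · simp only [coe_add, coe_mul, ← hp, ← hp', coe_pow, coe_sub, coe_one, coe_X]
      ring
    · rw [coeff_add] at hn
      by_cases h0 : (p * (1 - X ^ M) ^ r').coeff n = 0
      · rw [h0, zero_add] at hn
        rw [add_comm r]
        exact key p' r' r hc' n hn
      · exact key p r r' hc n h0

theorem properSubmodule_mono {M : ℕ} {b b' : ℝ} (h : b ≤ b') :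
    properSubmodule M b ≤ properSubmodule M b' := by
  rintro F ⟨r, p, hp, hc⟩
  exact ⟨r, p, hp, fun n hn => (hc n hn).trans_le (by linarith)⟩

theorem mem_properSubmodule_of_one_sub_mul {M : ℕ} {b : ℝ} {F : PowerSeries ℂ}
    (h : (1 - PowerSeries.X ^ M) * F ∈ properSubmodule M (b + M)) : F ∈ properSubmodule M b := by
  obtain ⟨r, p, hp, hc⟩ := h
  refine ⟨r + 1, p, by rw [← hp]; ring, fun n hn => (hc n hn).trans_le ?_⟩
  push_cast
  linarith

/-- Quasi-polynomiality of the coefficients of a proper rational function. -/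
theorem exists_quasiPolynomial_of_mem_properSubmodule {M : ℕ} (hM : 0 < M) {F : PowerSeries ℂ}
    (h : F ∈ properSubmodule M 0) :
    ∃ P : ℂ → ℂ[X],
      (∀ k : ℕ, PowerSeries.coeff k F =
        ∑ ζ ∈ nthRootsFinset M (1 : ℂ), ζ ^ k * (P ζ).eval (k : ℂ)) ∧
      ∀ j ζ, ζ ^ M = 1 → PoleLE ζ⁻¹ j F → (P ζ).degree < (j : WithBot ℕ) := by
  obtain ⟨r, p, hp, hc⟩ := h
  refine exists_quasiPolynomial M hM F r p hp ?_
  rw [degree_lt_iff_coeff_zero]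
  intro n hn
  by_contra h0
  have h1 := hc n h0
  rw [add_zero] at h1
  have h2 : n < M * r := by exact_mod_cast h1
  exact absurd hn (not_le.2 h2)

/-! ### Coordinate faces of the cone and their dimensions -/

/-- The face `x_I = 0` of the cone cut out by the orthant in the subspace `W`. -/
def coneFace {ι : Type*} (W : Submodule ℝ (ι → ℝ)) (I : Finset ι) : Set (ι → ℝ) :=
  {v | v ∈ W ∧ (∀ i, 0 ≤ v i) ∧ ∀ i ∈ I, v i = 0}

/-- The points of `ℕ^ι` in `W` with `o`-coordinate `k`, coordinates in `I` equal to those of `y`,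
and other coordinates at least those of `y`. -/
def slicePoints {ι : Type*} (W : Submodule ℝ (ι → ℝ)) (o : ι) (I : Finset ι) (y : ι → ℝ)
    (k : ℕ) : Set (ι → ℕ) :=
  {u | (fun i => (u i : ℝ)) ∈ W ∧ u o = k ∧ (∀ i, y i ≤ u i) ∧ ∀ i ∈ I, (u i : ℝ) = y i}

/-- The generating function of the numbers of points in slices. -/
noncomputable def sliceSeries {ι : Type*} (W : Submodule ℝ (ι → ℝ)) (o : ι) (I : Finset ι)
    (y : ι → ℝ) : PowerSeries ℂ :=
  PowerSeries.mk fun k => ((slicePoints W o I y k).ncard : ℂ)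

theorem zero_mem_coneFace {ι : Type*} (W : Submodule ℝ (ι → ℝ)) (I : Finset ι) :
    (0 : ι → ℝ) ∈ coneFace W I :=
  ⟨W.zero_mem, fun _ => le_rfl, fun _ _ => rfl⟩

theorem coneFace_anti {ι : Type*} (W : Submodule ℝ (ι → ℝ)) {I J : Finset ι} (h : I ⊆ J) :
    coneFace W J ⊆ coneFace W I :=
  fun _ hv => ⟨hv.1, hv.2.1, fun i hi => hv.2.2 i (h hi)⟩

theorem add_mem_coneFace {ι : Type*} {W : Submodule ℝ (ι → ℝ)} {I : Finset ι} {v w : ι → ℝ}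
    (hv : v ∈ coneFace W I) (hw : w ∈ coneFace W I) : v + w ∈ coneFace W I :=
  ⟨W.add_mem hv.1 hw.1, fun i => add_nonneg (hv.2.1 i) (hw.2.1 i),
    fun i hi => by rw [Pi.add_apply, hv.2.2 i hi, hw.2.2 i hi, add_zero]⟩

theorem smul_mem_coneFace {ι : Type*} {W : Submodule ℝ (ι → ℝ)} {I : Finset ι} {v : ι → ℝ}
    (hv : v ∈ coneFace W I) {c : ℝ} (hc : 0 ≤ c) : c • v ∈ coneFace W I :=
  ⟨W.smul_mem c hv.1, fun i => mul_nonneg hc (hv.2.1 i),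
    fun i hi => by rw [Pi.smul_apply, hv.2.2 i hi, smul_zero]⟩

theorem sum_mem_coneFace {ι κ : Type*} {W : Submodule ℝ (ι → ℝ)} {I : Finset ι} (s : Finset κ)
    {v : κ → ι → ℝ} (hv : ∀ i ∈ s, v i ∈ coneFace W I) : ∑ i ∈ s, v i ∈ coneFace W I := by
  classical
  induction s using Finset.induction_on with
  | empty => exact zero_mem_coneFace W I
  | insert a s ha ih =>
    rw [Finset.sum_insert ha]
    exact add_mem_coneFace (hv a (Finset.mem_insert_self a s))
      (ih fun i hi => hv i (Finset.mem_insert_of_mem hi))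

theorem span_coneFace_le {ι : Type*} (W : Submodule ℝ (ι → ℝ)) (I : Finset ι) {v : ι → ℝ}
    (hv : v ∈ Submodule.span ℝ (coneFace W I)) : v ∈ W ∧ ∀ i ∈ I, v i = 0 := by
  induction hv using Submodule.span_induction with
  | mem x hx => exact ⟨hx.1, hx.2.2⟩
  | zero => exact ⟨W.zero_mem, fun _ _ => rfl⟩
  | add x y _ _ hx hy =>
    exact ⟨W.add_mem hx.1 hy.1, fun i hi => by rw [Pi.add_apply, hx.2 i hi, hy.2 i hi, add_zero]⟩
  | smul c x _ hx =>
    exact ⟨W.smul_mem c hx.1, fun i hi => by rw [Pi.smul_apply, hx.2 i hi, smul_zero]⟩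

/-- The face has a point whose support contains the support of the whole face. -/
theorem exists_relint {ι : Type*} [Fintype ι] (W : Submodule ℝ (ι → ℝ)) (I : Finset ι) :
    ∃ p ∈ coneFace W I, ∀ v ∈ Submodule.span ℝ (coneFace W I), ∀ i, p i = 0 → v i = 0 := by
  have h : ∀ i, ∃ v ∈ coneFace W I, v i = 0 → ∀ x ∈ coneFace W I, x i = 0 := fun i => by
    by_cases hx : ∃ x ∈ coneFace W I, x i ≠ 0
    · obtain ⟨x, hx, hne⟩ := hx
      exact ⟨x, hx, fun h => absurd h hne⟩
    · push Not at hx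
      exact ⟨0, zero_mem_coneFace W I, fun _ => hx⟩
  choose v hv hv0 using h
  refine ⟨∑ i, v i, sum_mem_coneFace _ fun i _ => hv i, fun x hx i hi => ?_⟩
  rw [Finset.sum_apply, Finset.sum_eq_zero_iff_of_nonneg fun j _ => (hv j).2.1 i] at hi
  have hface := hv0 i (hi i (Finset.mem_univ i))
  induction hx using Submodule.span_induction with
  | mem x hx => exact hface x hx
  | zero => rfl
  | add x y _ _ hx hy => rw [Pi.add_apply, hx, hy, add_zero]
  | smul c x _ hx => rw [Pi.smul_apply, hx, smul_zero]

/-- Moving from a relatively interior point in a direction with a negative coordinate one reaches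
a proper face. -/
theorem mem_sup_of_neg {ι : Type*} [Fintype ι] [DecidableEq ι] (W : Submodule ℝ (ι → ℝ))
    (I : Finset ι) {p v : ι → ℝ} (hp : p ∈ coneFace W I)
    (hps : ∀ v ∈ Submodule.span ℝ (coneFace W I), ∀ i, p i = 0 → v i = 0)
    (hv : v ∈ Submodule.span ℝ (coneFace W I)) (hneg : ∃ i, v i < 0) :
    ∃ i ∉ I, v ∈ Submodule.span ℝ {p} ⊔ Submodule.span ℝ (coneFace W (insert i I)) := by
  set s : Finset ι := Finset.univ.filter fun i => v i < 0 with hs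
  have hsne : s.Nonempty := hneg.imp fun i hi => by simp [hs, hi]
  obtain ⟨i, hi, hmin⟩ := s.exists_min_image (fun i => p i / (-v i)) hsne
  have hvi : v i < 0 := by simpa [hs] using hi
  have hpi : 0 < p i := lt_of_le_of_ne (hp.2.1 i) fun h => hvi.ne (hps v hv i h.symm)
  -- The first time at which a coordinate of `p + t v` reaches zero; `i` is such a coordinate.
  set t := p i / (-v i) with ht
  have ht0 : 0 < t := div_pos hpi (neg_pos.2 hvi)
  have hvW := span_coneFace_le W I hv
  refine ⟨i, fun hiI => hpi.ne' (hp.2.2 i hiI), ?_⟩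
  have hq : p + t • v ∈ coneFace W (insert i I) := by
    refine ⟨W.add_mem hp.1 (W.smul_mem t hvW.1), fun k => ?_, fun k hk => ?_⟩
    · rw [Pi.add_apply, Pi.smul_apply, smul_eq_mul]
      rcases lt_or_ge (v k) 0 with hk | hk
      · have := hmin k (by simp [hs, hk])
        rw [le_div_iff₀ (neg_pos.2 hk)] at this
        linarith
      · exact add_nonneg (hp.2.1 k) (mul_nonneg ht0.le hk)
    · rw [Pi.add_apply, Pi.smul_apply, smul_eq_mul]
      rcases Finset.mem_insert.1 hk with rfl | hk
      · have := div_mul_cancel₀ (p k) (neg_pos.2 hvi).ne'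
        rw [← ht] at this
        linarith
      · rw [hp.2.2 k hk, hvW.2 k hk, mul_zero, add_zero]
  have hve : v = t⁻¹ • ((p + t • v) - p) := by
    rw [add_sub_cancel_left, smul_smul, inv_mul_cancel₀ ht0.ne', one_smul]
  rw [hve]
  refine Submodule.smul_mem _ _ (Submodule.sub_mem _ ?_ ?_)
  · exact Submodule.mem_sup_right (Submodule.subset_span hq)
  · exact Submodule.mem_sup_left (Submodule.mem_span_singleton_self p)

/-- For a nonzero `v` in the span, `v` or `-v` has a negative coordinate, so `v` lies in the span of
a relatively interior point `p` and a smaller face. A real vector space is not a finite union of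
proper subspaces, so a single smaller face together with `p` spans everything. -/
theorem exists_facet {ι : Type*} [Fintype ι] [DecidableEq ι] (W : Submodule ℝ (ι → ℝ))
    (I : Finset ι) (hI : ∃ v ∈ coneFace W I, v ≠ 0) :
    ∃ i ∉ I, Module.finrank ℝ (Submodule.span ℝ (coneFace W I)) ≤
      Module.finrank ℝ (Submodule.span ℝ (coneFace W (insert i I))) + 1 := by
  obtain ⟨p, hp, hps⟩ := exists_relint W I
  set D := Submodule.span ℝ (coneFace W I) with hD
  set E : ι → Submodule ℝ (ι → ℝ) := fun i =>
    Submodule.span ℝ {p} ⊔ Submodule.span ℝ (coneFace W (insert i I)) with hE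
  have hEle : ∀ i, E i ≤ D := fun i => sup_le
    (Submodule.span_le.2 (Set.singleton_subset_iff.2 (Submodule.subset_span hp)))
    (Submodule.span_mono (coneFace_anti W (Finset.subset_insert i I)))
  have hcov0 : ∀ v ∈ D, v ≠ 0 → ∃ i ∉ I, v ∈ E i := by
    intro v hv hv0
    by_cases hneg : ∃ i, v i < 0
    · exact mem_sup_of_neg W I hp hps hv hneg
    · push Not at hneg
      obtain ⟨i, hi⟩ := Function.ne_iff.1 hv0
      obtain ⟨k, hk, hmem⟩ := mem_sup_of_neg W I hp hps (D.neg_mem hv)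
        ⟨i, neg_lt_zero.2 (lt_of_le_of_ne (hneg i) (Ne.symm hi))⟩
      exact ⟨k, hk, by simpa using (E k).neg_mem hmem⟩
  have hcov : ∀ v ∈ D, ∃ i ∉ I, v ∈ E i := by
    intro v hv
    rcases eq_or_ne v 0 with rfl | hv0
    · obtain ⟨v, hv, hv0⟩ := hI
      obtain ⟨i, hi, -⟩ := hcov0 v (Submodule.subset_span hv) hv0
      exact ⟨i, hi, (E i).zero_mem⟩
    · exact hcov0 v hv hv0
  classical
  have htop := Subspace.top_mem_of_biUnion_eq_univ (k := ℝ) (E := D)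
    (s := (Finset.univ.filter fun i => i ∉ I).image fun i => (E i).comap D.subtype) (by
      rw [Set.eq_univ_iff_forall]
      intro v
      obtain ⟨i, hi, hmem⟩ := hcov v v.2
      simp only [Set.mem_iUnion]
      exact ⟨(E i).comap D.subtype, Finset.mem_image_of_mem _ (by simpa using hi), hmem⟩)
  obtain ⟨i, hi, htop⟩ := Finset.mem_image.1 htop
  refine ⟨i, by simpa using hi, ?_⟩
  have hDE : D ≤ E i := fun v hv => by
    have : (⟨v, hv⟩ : D) ∈ (E i).comap D.subtype := htop ▸ Submodule.mem_top
    exact this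
  calc Module.finrank ℝ D ≤ Module.finrank ℝ (E i) := Submodule.finrank_mono hDE
    _ ≤ Module.finrank ℝ (Submodule.span ℝ {p}) + _ := Submodule.finrank_add_le_finrank_add_finrank _ _
    _ ≤ _ := by
      rw [add_comm]
      exact Nat.add_le_add_left ((finrank_span_le_card {p}).trans (by simp)) _

/-- Descending through `exists_facet` lowers the dimension by at most one at a time, so no value is
skipped. -/
theorem exists_coneFace_of_finrank {ι : Type*} [Fintype ι] [DecidableEq ι]
    (W : Submodule ℝ (ι → ℝ)) (d : ℕ) (I : Finset ι)
    (h : d + 1 ≤ Module.finrank ℝ (Submodule.span ℝ (coneFace W I))) :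
    ∃ J, I ⊆ J ∧ Module.finrank ℝ (Submodule.span ℝ (coneFace W J)) = d + 1 := by
  induction hn : (Finset.univ \ I).card using Nat.strong_induction_on generalizing I with
  | _ n ih =>
  rcases h.eq_or_lt with h | h
  · exact ⟨I, subset_rfl, h.symm⟩
  have hI : ∃ v ∈ coneFace W I, v ≠ 0 := by
    by_contra! hI
    have : Submodule.span ℝ (coneFace W I) = ⊥ := by
      rw [Submodule.span_eq_bot]; exact hI
    rw [this, finrank_bot] at h
    omega
  obtain ⟨i, hi, hle⟩ := exists_facet W I hI
  obtain ⟨J, hJ, hd⟩ := ih _ (by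
    rw [← hn]
    refine Finset.card_lt_card (Finset.ssubset_iff_of_subset ?_ |>.2 ⟨i, by simp [hi], by simp⟩)
    exact Finset.sdiff_subset_sdiff subset_rfl (Finset.subset_insert i I)) (insert i I) (by omega) rfl
  exact ⟨J, (Finset.subset_insert i I).trans hJ, hd⟩

/-- Passing to a smaller face lowers the dimension. -/
theorem finrank_coneFace_insert_lt {ι : Type*} [Fintype ι] [DecidableEq ι]
    (W : Submodule ℝ (ι → ℝ)) (I : Finset ι) {w : ι → ℝ} (hw : w ∈ coneFace W I) {i : ι}
    (hi : w i ≠ 0) :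
    Module.finrank ℝ (Submodule.span ℝ (coneFace W (insert i I))) <
      Module.finrank ℝ (Submodule.span ℝ (coneFace W I)) := by
  refine Submodule.finrank_lt_finrank_of_lt (lt_of_le_of_ne
    (Submodule.span_mono (coneFace_anti W (Finset.subset_insert i I))) fun h => hi ?_)
  have : w ∈ Submodule.span ℝ (coneFace W (insert i I)) := h ▸ Submodule.subset_span hw
  exact (span_coneFace_le W _ this).2 i (Finset.mem_insert_self i I)

/-! ### Generating series of slices, and their behaviour under translation -/

theorem finite_of_antichain {ι : Type*} [Finite ι] {S : Set (ι → ℕ)}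
    (h : ∀ u ∈ S, ∀ v ∈ S, u ≤ v → u = v) : S.Finite :=
  IsAntichain.finite_of_partiallyWellOrderedOn
    (fun u hu v hv hne hle => hne (h u hu v hv hle)) (Set.isPWO_of_wellQuasiOrderedLE S)

/-- Two comparable points of a slice differ by a vector of the cone of height `0`, so they coincide;
Dickson's lemma makes antichains finite. -/
theorem finite_slicePoints {ι : Type*} [Finite ι] {W : Submodule ℝ (ι → ℝ)} {o : ι}
    (hpt : ∀ v ∈ W, (∀ i, 0 ≤ v i) → v o = 0 → v = 0) (I : Finset ι) (y : ι → ℝ) (k : ℕ) :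
    (slicePoints W o I y k).Finite := by
  refine finite_of_antichain fun u hu v hv hle => ?_
  have h := hpt (fun i => (v i : ℝ) - u i) (W.sub_mem hv.1 hu.1)
    (fun i => sub_nonneg.2 (Nat.cast_le.2 (hle i))) (by simp [hu.2.1, hv.2.1])
  funext i
  have h1 : (v i : ℝ) - u i = 0 := congrFun h i
  exact_mod_cast (sub_eq_zero.1 h1).symm

/-- Adding `z` is a bijection between the point sets. Nonnegativity of both `y` and `y'` keeps all
translated points in `ℕ^ι`, even though `z` may have negative coordinates. -/
theorem sliceSeries_shift {ι : Type*} {W : Submodule ℝ (ι → ℝ)} {o : ι}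
    (I : Finset ι) {y y' : ι → ℝ} (hy : ∀ i, 0 ≤ y i) (hy' : ∀ i, 0 ≤ y' i) {z : ι → ℤ}
    (hz : (fun i => (z i : ℝ)) ∈ W) (hyz : ∀ i, y' i = y i + z i) {h : ℕ} (ho : z o = h) :
    sliceSeries W o I y' = PowerSeries.X ^ h * sliceSeries W o I y := by
  ext k
  rw [PowerSeries.coeff_X_pow_mul']
  split_ifs with hk
  · rw [sliceSeries, sliceSeries, PowerSeries.coeff_mk, PowerSeries.coeff_mk]
    congr 1
    have hcast : ∀ u ∈ slicePoints W o I y (k - h), ∀ i,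
        (((u i + z i).toNat : ℕ) : ℝ) = u i + z i := by
      intro u hu i
      have h1 : (0 : ℝ) ≤ ((u i + z i : ℤ) : ℝ) := by
        have h2 := hu.2.2.1 i
        have h3 := hy' i
        rw [hyz] at h3
        push_cast
        linarith
      have h4 : (((u i + z i).toNat : ℤ) : ℝ) = ((u i + z i : ℤ) : ℝ) := by
        rw [Int.toNat_of_nonneg (by exact_mod_cast h1)]
      push_cast at h4
      exact h4
    symm
    refine Set.ncard_congr (fun u _ i => (u i + z i).toNat) ?_ ?_ ?_
    · intro u hu
      refine ⟨?_, ?_, fun i => ?_, fun i hi => ?_⟩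
      · have : (fun i => (((u i + z i).toNat : ℕ) : ℝ)) = (fun i => (u i : ℝ)) + fun i => (z i : ℝ) :=
          funext fun i => hcast u hu i
        rw [this]
        exact W.add_mem hu.1 hz
      · have := hu.2.1
        beta_reduce
        omega
      · rw [hcast u hu, hyz]
        linarith [hu.2.2.1 i]
      · rw [hcast u hu, hyz, hu.2.2.2 i hi]
    · intro u v hu hv huv
      funext i
      have h1 := hcast u hu i
      have h2 := hcast v hv i
      have h3 : (u i + z i).toNat = (v i + z i).toNat := congrFun huv i
      rw [h3, h2] at h1
      have h4 : (v i : ℝ) = u i := by linarith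
      exact_mod_cast h4.symm
    · intro v hv
      have hcast' : ∀ i, (((v i - z i).toNat : ℕ) : ℤ) = v i - z i := fun i => by
        apply Int.toNat_of_nonneg
        have h1 := hv.2.2.1 i
        rw [hyz] at h1
        have h2 : (0 : ℝ) ≤ ((v i - z i : ℤ) : ℝ) := by
          push_cast
          linarith [hy i]
        exact_mod_cast h2
      have hcast'' : ∀ i, (((v i - z i).toNat : ℕ) : ℝ) = v i - z i := fun i => by
        exact_mod_cast congrArg (fun n : ℤ => (n : ℝ)) (hcast' i)
      refine ⟨fun i => (v i - z i).toNat, ⟨?_, ?_, fun i => ?_, fun i hi => ?_⟩, ?_⟩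
      · have : (fun i => (((v i - z i).toNat : ℕ) : ℝ)) = (fun i => (v i : ℝ)) - fun i => (z i : ℝ) :=
          funext fun i => hcast'' i
        rw [this]
        exact W.sub_mem hv.1 hz
      · have := hv.2.1
        simp only
        omega
      · rw [hcast'']
        linarith [hv.2.2.1 i, hyz i]
      · rw [hcast'', hv.2.2.2 i hi, hyz]
        ring
      · funext i
        simp only
        have := hcast' i
        omega
  · rw [sliceSeries, PowerSeries.coeff_mk]
    have : slicePoints W o I y' k = ∅ := by
      rw [Set.eq_empty_iff_forall_notMem]
      intro u hu
      have h1 := hu.2.2.1 o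
      rw [hyz, ho, hu.2.1] at h1
      have h2 : (h : ℝ) ≤ k := by
        have := hy o
        push_cast at h1
        linarith
      exact hk (by exact_mod_cast h2)
    rw [this, Set.ncard_empty, Nat.cast_zero]

/-- An integral point with `u i ≥ a i` has either `u i ≥ a i + 1` or `u i = a i`. -/
theorem sliceSeries_eq_update_add {ι : Type*} [Fintype ι] [DecidableEq ι]
    {W : Submodule ℝ (ι → ℝ)} {o : ι} (hpt : ∀ v ∈ W, (∀ i, 0 ≤ v i) → v o = 0 → v = 0)
    {I : Finset ι} (a : ι → ℕ) {i : ι} (hi : i ∉ I) :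
    sliceSeries W o I (fun k => (a k : ℝ)) =
      sliceSeries W o I (fun k => ((Function.update a i (a i + 1) k : ℕ) : ℝ)) +
        sliceSeries W o (insert i I) fun k => (a k : ℝ) := by
  ext k
  rw [map_add]
  simp only [sliceSeries, PowerSeries.coeff_mk]
  rw [← Nat.cast_add, ← Set.ncard_union_eq _ (finite_slicePoints hpt _ _ _)
    (finite_slicePoints hpt _ _ _)]
  · congr 2
    ext u
    constructor
    · rintro ⟨hW, ho, hle, hI⟩
      rcases (Nat.cast_le.1 (hle i)).eq_or_lt with h | h
      · refine Or.inr ⟨hW, ho, hle, fun j hj => ?_⟩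
        rcases Finset.mem_insert.1 hj with rfl | hj
        · exact (Nat.cast_inj.2 h).symm
        · exact hI j hj
      · refine Or.inl ⟨hW, ho, fun j => ?_, fun j hj => ?_⟩ <;> beta_reduce
        · rcases eq_or_ne j i with rfl | hne
          · rw [Function.update_self]; exact Nat.cast_le.2 h
          · rw [Function.update_of_ne hne]; exact hle j
        · rw [Function.update_of_ne (ne_of_mem_of_not_mem hj hi)]; exact hI j hj
    · rintro (⟨hW, ho, hle, hI⟩ | ⟨hW, ho, hle, hI⟩)
      · refine ⟨hW, ho, fun j => ?_, fun j hj => ?_⟩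
        · have := Nat.cast_le.1 (hle j)
          refine Nat.cast_le.2 (le_trans ?_ this)
          rcases eq_or_ne j i with rfl | hne
          · rw [Function.update_self]; exact Nat.le_succ _
          · rw [Function.update_of_ne hne]
        · have := hI j hj
          beta_reduce at this
          rwa [Function.update_of_ne (ne_of_mem_of_not_mem hj hi)] at this
      · exact ⟨hW, ho, hle, fun j hj => hI j (Finset.mem_insert_of_mem hj)⟩
  · rw [Set.disjoint_left]
    rintro u hu hu'
    have h1 := hu.2.2.1 i
    have h2 := hu'.2.2.2 i (Finset.mem_insert_self i I)
    simp only [Function.update_self] at h1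
    rw [h2] at h1
    push_cast at h1
    linarith

/-! ### Bounds for the pole orders -/

/-- Go from `a` to `b` by unit steps; each step in coordinate `i` costs one series of the smaller
face `insert i I`. The intermediate translations need not lie in `W`. -/
theorem poleLE_sliceSeries_sub {ι : Type*} [Fintype ι] [DecidableEq ι]
    {W : Submodule ℝ (ι → ℝ)} {o : ι} (hpt : ∀ v ∈ W, (∀ i, 0 ≤ v i) → v o = 0 → v = 0)
    {ζ : ℂ} {d : ℕ} {I : Finset ι} (a b : ι → ℕ) (hab : a ≤ b)
    (h : ∀ i, a i < b i → i ∉ I ∧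
      ∀ c : ι → ℕ, PoleLE ζ d (sliceSeries W o (insert i I) fun k => (c k : ℝ))) :
    PoleLE ζ d (sliceSeries W o I (fun k => (a k : ℝ)) - sliceSeries W o I fun k => (b k : ℝ)) := by
  induction hn : ∑ i, (b i - a i) using Nat.strong_induction_on generalizing a with
  | _ n ih =>
  by_cases hex : ∃ i, a i < b i
  · obtain ⟨i, hi⟩ := hex
    obtain ⟨hiI, hc⟩ := h i hi
    have hlt : ∀ j, a j ≤ Function.update a i (a i + 1) j := fun j => by
      rcases eq_or_ne j i with rfl | hne
      · rw [Function.update_self]; exact Nat.le_succ _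
      · rw [Function.update_of_ne hne]
    have := ih _ (by
      rw [← hn]
      refine Finset.sum_lt_sum (fun j _ => Nat.sub_le_sub_left (hlt j) _) ⟨i, Finset.mem_univ i, ?_⟩
      rw [Function.update_self]; omega) (Function.update a i (a i + 1)) (fun j => by
        rcases eq_or_ne j i with rfl | hne
        · rw [Function.update_self]; exact hi
        · rw [Function.update_of_ne hne]; exact hab j)
      (fun j hj => h j ((hlt j).trans_lt hj)) rfl
    rw [sliceSeries_eq_update_add hpt a hiI, add_sub_right_comm]
    exact this.add (hc a)
  · push Not at hex
    rw [le_antisymm hab hex, sub_self]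
    simpa using PoleLE.of_polynomial ζ d 0

/-- Translation by a lattice vector `w` of the face turns the difference of series into `(1 - X^M)
F`. The difference involves only faces of smaller dimension, and division by `1 - X^M` adds one to
the pole order. -/
theorem poleLE_sliceSeries_finrank {ι : Type*} [Fintype ι] [DecidableEq ι]
    {W : Submodule ℝ (ι → ℝ)} {o : ι} (hpt : ∀ v ∈ W, (∀ i, 0 ≤ v i) → v o = 0 → v = 0)
    {M : ℕ} (hM : 0 < M)
    (hvert : ∀ I : Finset ι, (∃ v ∈ coneFace W I, v ≠ 0) →
      ∃ w : ι → ℕ, (fun i => (w i : ℝ)) ∈ coneFace W I ∧ w o = M)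
    {ζ : ℂ} (hζ : ζ ^ M = 1) (I : Finset ι) (a : ι → ℕ) :
    PoleLE ζ (Module.finrank ℝ (Submodule.span ℝ (coneFace W I)))
      (sliceSeries W o I fun k => (a k : ℝ)) := by
  induction hn : (Finset.univ \ I).card using Nat.strong_induction_on generalizing I a with
  | _ n ih =>
  by_cases hI : ∃ v ∈ coneFace W I, v ≠ 0
  · obtain ⟨w, hw, hwo⟩ := hvert I hI
    have hpos : 0 < Module.finrank ℝ (Submodule.span ℝ (coneFace W I)) :=
      (Nat.zero_le _).trans_lt (finrank_coneFace_insert_lt W I hw (i := o) (by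
        simp [hwo, hM.ne']))
    obtain ⟨d, hd⟩ := Nat.exists_eq_add_one.2 hpos
    rw [hd]
    refine PoleLE.of_one_sub_X_pow_mul hM hζ ?_
    have h1 := poleLE_sliceSeries_sub (ζ := ζ) (d := d) hpt (I := I) a (fun k => a k + w k)
      (fun k => Nat.le_add_right _ _) (fun i hi => by
        have hwi : w i ≠ 0 := by omega
        have hwi' : (w i : ℝ) ≠ 0 := Nat.cast_ne_zero.2 hwi
        have hiI : i ∉ I := fun h => hwi' (hw.2.2 i h)
        refine ⟨hiI, fun c => ?_⟩
        refine (ih _ ?_ (insert i I) c rfl).mono ?_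
        · rw [← hn]
          refine Finset.card_lt_card
            (Finset.ssubset_iff_of_subset ?_ |>.2 ⟨i, by simp [hiI], by simp⟩)
          exact Finset.sdiff_subset_sdiff subset_rfl (Finset.subset_insert i I)
        · have := finrank_coneFace_insert_lt W I hw (i := i) hwi'
          omega)
    rwa [sliceSeries_shift I (y := fun k => (a k : ℝ)) (y' := fun k => ((a k + w k : ℕ) : ℝ))
      (z := fun k => (w k : ℤ)) (h := M)
      (fun _ => Nat.cast_nonneg _) (fun _ => Nat.cast_nonneg _) (by simpa using hw.1)
      (fun i => by push_cast; rfl) (by simp [hwo]), ← one_sub_mul] at h1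
  · push Not at hI
    -- For the zero face, the points of all heights together form an antichain, so the series is a
    -- polynomial.
    have hfin : {u : ι → ℕ | ∃ k, u ∈ slicePoints W o I (fun k => (a k : ℝ)) k}.Finite := by
      refine finite_of_antichain ?_
      rintro u ⟨k, hu⟩ v ⟨l, hv⟩ hle
      have h := hI (fun i => (v i : ℝ) - u i) ⟨W.sub_mem hv.1 hu.1,
        fun i => sub_nonneg.2 (Nat.cast_le.2 (hle i)), fun i hi => by
          simp only [hu.2.2.2 i hi, hv.2.2.2 i hi, sub_self]⟩
      funext i
      have h1 : (v i : ℝ) - u i = 0 := congrFun h i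
      exact_mod_cast (sub_eq_zero.1 h1).symm
    obtain ⟨B, hB⟩ := (hfin.image fun u => u o).bddAbove
    have hpoly : sliceSeries W o I (fun k => (a k : ℝ)) =
        (PowerSeries.trunc (B + 1) (sliceSeries W o I fun k => (a k : ℝ)) : PowerSeries ℂ) := by
      ext k
      rw [Polynomial.coeff_coe, PowerSeries.coeff_trunc]
      split_ifs with hk
      · rfl
      · rw [sliceSeries, PowerSeries.coeff_mk]
        have : slicePoints W o I (fun k => (a k : ℝ)) k = ∅ := by
          rw [Set.eq_empty_iff_forall_notMem]
          intro u hu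
          have := hB ⟨u, ⟨k, hu⟩, hu.2.1⟩
          omega
        rw [this, Set.ncard_empty, Nat.cast_zero]
    rw [hpoly]
    exact PoleLE.of_polynomial _ _ _

/-- If every face of dimension `j + 1` of the cone has a lattice point of height one in its span,
the poles different from `1` have order at most `j`. -/
theorem poleLE_sliceSeries_of_reticular {ι : Type*} [Fintype ι] [DecidableEq ι]
    {W : Submodule ℝ (ι → ℝ)} {o : ι} (hpt : ∀ v ∈ W, (∀ i, 0 ≤ v i) → v o = 0 → v = 0)
    {M : ℕ} (hM : 0 < M)
    (hvert : ∀ I : Finset ι, (∃ v ∈ coneFace W I, v ≠ 0) →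
      ∃ w : ι → ℕ, (fun i => (w i : ℝ)) ∈ coneFace W I ∧ w o = M)
    {ζ : ℂ} (hζ : ζ ^ M = 1) (hζ1 : ζ ≠ 1) {j : ℕ}
    (hret : ∀ I : Finset ι, Module.finrank ℝ (Submodule.span ℝ (coneFace W I)) = j + 1 →
      ∃ z : ι → ℤ, (fun i => (z i : ℝ)) ∈ Submodule.span ℝ (coneFace W I) ∧ z o = 1)
    (I : Finset ι) (a : ι → ℕ) :
    PoleLE ζ j (sliceSeries W o I fun k => (a k : ℝ)) := by
  induction hn : (Finset.univ \ I).card using Nat.strong_induction_on generalizing I a with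
  | _ n ih =>
  rcases Nat.lt_or_ge j (Module.finrank ℝ (Submodule.span ℝ (coneFace W I))) with hj | hj
  · obtain ⟨J, hIJ, hJ⟩ := exists_coneFace_of_finrank W j I hj
    obtain ⟨z, hz, hzo⟩ := hret J hJ
    obtain ⟨hzW, hzJ⟩ := span_coneFace_le W J hz
    have hstep : ∀ b : ι → ℕ, a ≤ b → (∀ i, a i < b i → z i ≠ 0) →
        PoleLE ζ j (sliceSeries W o I (fun k => (a k : ℝ)) -
          sliceSeries W o I fun k => (b k : ℝ)) := by
      intro b hab hb
      refine poleLE_sliceSeries_sub hpt a b hab fun i hi => ?_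
      have hiI : i ∉ I := fun h => hb i hi (by exact_mod_cast hzJ i (hIJ h))
      refine ⟨hiI, fun c => ih _ ?_ (insert i I) c rfl⟩
      rw [← hn]
      refine Finset.card_lt_card (Finset.ssubset_iff_of_subset ?_ |>.2 ⟨i, by simp [hiI], by simp⟩)
      exact Finset.sdiff_subset_sdiff subset_rfl (Finset.subset_insert i I)
    -- Splitting `z` into positive and negative parts gives `c = b + z` with `a ≤ b` and `a ≤ c`.
    -- Only coordinates with `z k ≠ 0` change, and these lie outside `J ⊇ I`. So `F_a - F_b` and
    -- `F_a - F_c` are controlled by induction, while `F_c = X F_b`.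
    set b : ι → ℕ := fun k => a k + (-z k).toNat with hb
    set c : ι → ℕ := fun k => a k + (z k).toNat with hc
    have h1 := hstep b (fun k => Nat.le_add_right _ _) fun i hi => by
      intro h; simp [hb, h] at hi
    have h2 := hstep c (fun k => Nat.le_add_right _ _) fun i hi => by
      intro h; simp [hc, h] at hi
    have h3 := h2.sub h1
    rw [sub_sub_sub_cancel_left, sliceSeries_shift I (y := fun k => (b k : ℝ))
      (y' := fun k => (c k : ℝ)) (z := z) (h := 1)
      (fun _ => Nat.cast_nonneg _) (fun _ => Nat.cast_nonneg _) hzW (fun i => by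
        have : (c i : ℤ) = b i + z i := by simp only [hb, hc]; omega
        exact_mod_cast congrArg (fun n : ℤ => (n : ℝ)) this) (by simp [hzo]), pow_one,
      ← one_sub_mul] at h3
    have h4 := h1.add (h3.of_one_sub_X_mul hζ1)
    rwa [sub_add_cancel] at h4
  · exact (poleLE_sliceSeries_finrank hpt hM hvert hζ I a).mono hj

/-! ### Sliding a cone along a lattice vector: rationality and properness -/

/-- The parameters `τ ∈ [0, 1)` at which `y + τ w` meets an integral coordinate hyperplane
transverse to `w`. -/
def crossings {ι : Type*} (y : ι → ℝ) (w : ι → ℕ) : Set ℝ :=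
  {τ | 0 ≤ τ ∧ τ < 1 ∧ ∃ i, w i ≠ 0 ∧ ∃ n : ℕ, (n : ℝ) = y i + τ * w i}

theorem finite_crossings {ι : Type*} [Finite ι] (y : ι → ℝ) (w : ι → ℕ) :
    (crossings y w).Finite := by
  have h : (⋃ i, (fun n : ℕ => ((n : ℝ) - y i) / w i) '' {n | n ≤ ⌈y i + w i⌉₊}).Finite :=
    Set.finite_iUnion fun i => (Set.finite_le_nat _).image _
  refine h.subset ?_
  rintro τ ⟨h0, h1, i, hi, n, hn⟩
  have hw : (0 : ℝ) < w i := Nat.cast_pos.2 (Nat.pos_of_ne_zero hi)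
  refine Set.mem_iUnion.2 ⟨i, n, ?_, ?_⟩
  · have h2 : (n : ℝ) ≤ y i + w i := by
      rw [hn]
      nlinarith
    exact Nat.cast_le.1 (h2.trans (Nat.le_ceil _))
  · simp only [hn]
    field_simp
    ring

/-- As `τ` grows, a point is lost just after the moment when it lies on the boundary of the cone
translated by `y + τ w`, that is, at the least ratio `(u i - y i) / w i`. -/
theorem slicePoints_diff_eq {ι : Type*} [Fintype ι] [DecidableEq ι]
    {W : Submodule ℝ (ι → ℝ)} {o : ι} {I : Finset ι} {y : ι → ℝ} {w : ι → ℕ}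
    (hw : (fun i => (w i : ℝ)) ∈ coneFace W I) (k : ℕ) :
    slicePoints W o I y k \ slicePoints W o I (fun i => y i + w i) k =
      ⋃ τ ∈ crossings y w, ⋃ i ∈ Finset.univ.filter fun i => w i ≠ 0,
        slicePoints W o (insert i I) (fun i => y i + τ * w i) k := by
  ext u
  simp only [Set.mem_iUnion, Finset.mem_filter, Finset.mem_univ, true_and, exists_prop]
  constructor
  · rintro ⟨⟨hW, ho, hle, hI⟩, hnot⟩
    have hex : ∃ i, (u i : ℝ) < y i + w i := by
      by_contra! hge
      exact hnot ⟨hW, ho, hge, fun i hi => by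
        beta_reduce
        rw [hI i hi, show (w i : ℝ) = 0 from hw.2.2 i hi, add_zero]⟩
    obtain ⟨i₁, hi₁⟩ := hex
    have hwi₁ : w i₁ ≠ 0 := fun h => by
      rw [h, Nat.cast_zero, add_zero] at hi₁
      exact absurd (hle i₁) (not_le.2 hi₁)
    obtain ⟨i, hi, hmin⟩ := (Finset.univ.filter fun i => w i ≠ 0).exists_min_image
      (fun i => ((u i : ℝ) - y i) / w i) ⟨i₁, by simp [hwi₁]⟩
    have hwi : w i ≠ 0 := by simpa using hi
    have hpos : ∀ {i}, w i ≠ 0 → (0 : ℝ) < w i := fun h => Nat.cast_pos.2 (Nat.pos_of_ne_zero h)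
    have hui : (u i : ℝ) = y i + ((u i : ℝ) - y i) / w i * w i := by
      rw [div_mul_cancel₀ _ (hpos hwi).ne']; ring
    refine ⟨((u i : ℝ) - y i) / w i, ⟨div_nonneg (sub_nonneg.2 (hle i)) (hpos hwi).le, ?_, i, hwi,
      u i, hui⟩, i, hwi, hW, ho, fun l => ?_, fun l hl => ?_⟩
    · refine (hmin i₁ (by simp [hwi₁])).trans_lt ?_
      rw [div_lt_one (hpos hwi₁)]
      linarith
    · by_cases hl : w l = 0
      · simp only [hl, Nat.cast_zero, mul_zero, add_zero]; exact hle l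
      · have := hmin l (by simp [hl])
        rw [le_div_iff₀ (hpos hl)] at this
        linarith
    · rcases Finset.mem_insert.1 hl with rfl | hl
      · exact hui
      · have : (w l : ℝ) = 0 := hw.2.2 l hl
        simp only [this, mul_zero, add_zero]
        exact hI l hl
  · rintro ⟨τ, ⟨h0, h1, -⟩, i, hwi, hW, ho, hle, hI⟩
    refine ⟨⟨hW, ho, fun l => ?_, fun l hl => ?_⟩, fun h => ?_⟩
    · have := hle l
      have h2 : 0 ≤ τ * w l := mul_nonneg h0 (Nat.cast_nonneg _)
      simp only at this
      linarith
    · have h2 : (w l : ℝ) = 0 := hw.2.2 l hl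
      have := hI l (Finset.mem_insert_of_mem hl)
      simpa only [h2, mul_zero, add_zero] using this
    · have h2 := hI i (Finset.mem_insert_self i I)
      have h3 := h.2.2.1 i
      simp only [h2] at h3
      have hpos : (0 : ℝ) < w i := Nat.cast_pos.2 (Nat.pos_of_ne_zero hwi)
      nlinarith

/-- Different crossing times lose disjoint sets of points. At a fixed time the lost points lie on a
union of facets, whose intersections are again coordinate faces `I ∪ A`, so inclusion–exclusion
applies. -/
theorem ncard_slicePoints_sub {ι : Type*} [Fintype ι] [DecidableEq ι]
    {W : Submodule ℝ (ι → ℝ)} {o : ι} (hpt : ∀ v ∈ W, (∀ i, 0 ≤ v i) → v o = 0 → v = 0)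
    {I : Finset ι} {y : ι → ℝ} {w : ι → ℕ}
    (hw : (fun i => (w i : ℝ)) ∈ coneFace W I) (k : ℕ) :
    ((slicePoints W o I y k).ncard : ℤ) - (slicePoints W o I (fun i => y i + w i) k).ncard =
      ∑ τ ∈ (finite_crossings y w).toFinset,
        ∑ A ∈ (Finset.univ.filter fun i => w i ≠ 0).powerset.filter (·.Nonempty),
          (-1) ^ (A.card + 1) *
            ((slicePoints W o (I ∪ A) (fun i => y i + τ * w i) k).ncard : ℤ) := by
  set s := Finset.univ.filter fun i => w i ≠ 0 with hs
  have hfin := fun I y => finite_slicePoints hpt I y k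
  let P : Finset ι → (ι → ℝ) → Finset (ι → ℕ) := fun I y => (hfin I y).toFinset
  have hP : ∀ I y, (slicePoints W o I y k).ncard = (P I y).card := fun I y =>
    Set.ncard_eq_toFinset_card _ (hfin I y)
  have hsub : P I (fun i => y i + w i) ⊆ P I y := by
    intro u hu
    simp only [P, Set.Finite.mem_toFinset] at hu ⊢
    refine ⟨hu.1, hu.2.1, fun i => ?_, fun i hi => ?_⟩
    · exact (le_add_of_nonneg_right (Nat.cast_nonneg _)).trans (hu.2.2.1 i)
    · rw [hu.2.2.2 i hi]
      beta_reduce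
      rw [show (w i : ℝ) = 0 from hw.2.2 i hi, add_zero]
  have hdiff : P I y \ P I (fun i => y i + w i) = (finite_crossings y w).toFinset.biUnion
      fun τ => s.biUnion fun i => P (insert i I) (fun i => y i + τ * w i) := by
    apply Finset.coe_injective
    rw [Finset.coe_sdiff]
    simp only [P, Finset.coe_biUnion, Set.Finite.coe_toFinset]
    exact slicePoints_diff_eq hw k
  rw [hP, hP, ← Nat.cast_sub (Finset.card_le_card hsub), ← Finset.card_sdiff_of_subset hsub, hdiff,
    Finset.card_biUnion, Nat.cast_sum]
  · refine Finset.sum_congr rfl fun τ _ => ?_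
    rw [Finset.inclusion_exclusion_card_biUnion, Finset.sum_coe_sort
      (s.powerset.filter (·.Nonempty)) (fun A => (-1 : ℤ) ^ (A.card + 1) *
        ((slicePoints W o (I ∪ A) (fun i => y i + τ * w i) k).ncard : ℤ)) |>.symm]
    refine Finset.sum_congr rfl fun A _ => ?_
    rw [hP]
    congr 3
    ext u
    rw [Finset.mem_inf']
    obtain ⟨i, hi⟩ := (Finset.mem_filter.1 A.2).2
    simp only [P, Set.Finite.mem_toFinset]
    constructor
    · intro h
      refine ⟨(h i hi).1, (h i hi).2.1, (h i hi).2.2.1, fun l hl => ?_⟩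
      rcases Finset.mem_union.1 hl with hl | hl
      · exact (h i hi).2.2.2 l (Finset.mem_insert_of_mem hl)
      · exact (h l hl).2.2.2 l (Finset.mem_insert_self l I)
    · intro h l hl
      refine ⟨h.1, h.2.1, h.2.2.1, fun m hm => h.2.2.2 m ?_⟩
      rcases Finset.mem_insert.1 hm with rfl | hm
      · exact Finset.mem_union_right _ hl
      · exact Finset.mem_union_left _ hm
  · have key : ∀ τ σ : ℝ, τ < σ → ∀ u : ι → ℕ,
        u ∈ (s.biUnion fun i => P (insert i I) fun i => y i + τ * w i) →
        u ∉ (s.biUnion fun i => P (insert i I) fun i => y i + σ * w i) := by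
      intro τ σ hlt u hu hu'
      simp only [Finset.mem_biUnion, P, Set.Finite.mem_toFinset] at hu hu'
      obtain ⟨i, hi, hu⟩ := hu
      obtain ⟨i', _, hu'⟩ := hu'
      have h1 := hu.2.2.2 i (Finset.mem_insert_self i I)
      have h2 := hu'.2.2.1 i
      simp only [h1] at h2
      have hwi : w i ≠ 0 := by simpa [hs] using hi
      have hpos : (0 : ℝ) < w i := Nat.cast_pos.2 (Nat.pos_of_ne_zero hwi)
      nlinarith
    intro τ _ σ _ hne
    rw [Function.onFun, Finset.disjoint_left]
    intro u hu hu'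
    rcases hne.lt_or_gt with h | h
    · exact key τ σ h u hu hu'
    · exact key σ τ h u hu' hu

theorem one_sub_mul_sliceSeries {ι : Type*} [Fintype ι] [DecidableEq ι]
    {W : Submodule ℝ (ι → ℝ)} {o : ι} (hpt : ∀ v ∈ W, (∀ i, 0 ≤ v i) → v o = 0 → v = 0)
    {I : Finset ι} {y : ι → ℝ} (hy : ∀ i, 0 ≤ y i) {w : ι → ℕ}
    (hw : (fun i => (w i : ℝ)) ∈ coneFace W I) :
    (1 - PowerSeries.X ^ w o) * sliceSeries W o I y =
      ∑ τ ∈ (finite_crossings y w).toFinset,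
        ∑ A ∈ (Finset.univ.filter fun i => w i ≠ 0).powerset.filter (·.Nonempty),
          ((-1 : ℂ) ^ (A.card + 1)) • sliceSeries W o (I ∪ A) (fun i => y i + τ * w i) := by
  rw [one_sub_mul, ← sliceSeries_shift I (y' := fun i => y i + w i) (z := fun i => w i) hy
    (fun i => add_nonneg (hy i) (Nat.cast_nonneg _)) (by simpa using hw.1)
    (fun i => by push_cast; rfl) rfl]
  ext k
  have h := congrArg (fun n : ℤ => (n : ℂ)) (ncard_slicePoints_sub (y := y) hpt hw k)
  simp only [map_sub, map_sum, PowerSeries.coeff_smul, sliceSeries, PowerSeries.coeff_mk,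
    smul_eq_mul]
  push_cast at h
  exact h

/-- The two clauses differ because of the zero face: there the series is `0` or the monomial of
degree `y o`, which satisfies the strict bound only for `b > y o`. For other faces the slack `τ < 1`
restores the sharp bound `y o`. -/
theorem sliceSeries_mem_properSubmodule {ι : Type*} [Fintype ι] [DecidableEq ι]
    {W : Submodule ℝ (ι → ℝ)} {o : ι} (hpt : ∀ v ∈ W, (∀ i, 0 ≤ v i) → v o = 0 → v = 0)
    {M : ℕ} (hM : 0 < M)
    (hvert : ∀ I : Finset ι, (∃ v ∈ coneFace W I, v ≠ 0) →
      ∃ w : ι → ℕ, (fun i => (w i : ℝ)) ∈ coneFace W I ∧ w o = M)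
    (I : Finset ι) {y : ι → ℝ} (hyW : y ∈ W) (hy : ∀ i, 0 ≤ y i) :
    (∀ b > y o, sliceSeries W o I y ∈ properSubmodule M b) ∧
      ((∃ v ∈ coneFace W I, v ≠ 0) → sliceSeries W o I y ∈ properSubmodule M (y o)) := by
  induction hn : (Finset.univ \ I).card using Nat.strong_induction_on generalizing I y with
  | _ n ih =>
  have hmain : (∃ v ∈ coneFace W I, v ≠ 0) → sliceSeries W o I y ∈ properSubmodule M (y o) := by
    intro hI
    obtain ⟨w, hw, hwo⟩ := hvert I hI
    apply mem_properSubmodule_of_one_sub_mul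
    rw [← hwo, one_sub_mul_sliceSeries hpt hy hw, hwo]
    refine Submodule.sum_mem _ fun τ hτ => Submodule.sum_mem _ fun A hA =>
      Submodule.smul_mem _ _ ?_
    obtain ⟨h0, h1, -⟩ := (Set.Finite.mem_toFinset _).1 hτ
    obtain ⟨hAs, i, hiA⟩ := Finset.mem_filter.1 hA
    have hwi : w i ≠ 0 := by simpa using Finset.mem_powerset.1 hAs hiA
    have hiI : i ∉ I := fun h => hwi (Nat.cast_eq_zero.1 (hw.2.2 i h : (w i : ℝ) = 0))
    refine (ih _ ?_ (I ∪ A) (W.add_mem hyW (W.smul_mem τ hw.1)) (fun i => ?_) rfl).1 _ ?_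
    · rw [← hn]
      refine Finset.card_lt_card
        (Finset.ssubset_iff_of_subset ?_ |>.2 ⟨i, by simp [hiI], by simp [hiA]⟩)
      exact Finset.sdiff_subset_sdiff subset_rfl Finset.subset_union_left
    · exact add_nonneg (hy i) (mul_nonneg h0 (Nat.cast_nonneg _))
    · have : (0 : ℝ) < M := Nat.cast_pos.2 hM
      simp only [Pi.add_apply, Pi.smul_apply, smul_eq_mul, hwo]
      nlinarith
  refine ⟨fun b hb => ?_, hmain⟩
  by_cases hI : ∃ v ∈ coneFace W I, v ≠ 0
  · exact properSubmodule_mono hb.le (hmain hI)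
  push Not at hI
  -- Since `y ∈ W`, the vector `u - y` belongs to the zero face.
  have huniq : ∀ k, ∀ u ∈ slicePoints W o I y k, ∀ i, (u i : ℝ) = y i := fun k u hu i => by
    have := hI (fun i => (u i : ℝ) - y i) ⟨W.sub_mem hu.1 hyW, fun i => sub_nonneg.2 (hu.2.2.1 i),
      fun i hi => sub_eq_zero.2 (hu.2.2.2 i hi)⟩
    exact sub_eq_zero.1 (congrFun this i)
  by_cases hex : ∃ k, ∃ u, u ∈ slicePoints W o I y k
  · obtain ⟨m, u, hu⟩ := hex
    have hpoint : ∀ k, slicePoints W o I y k = if k = m then {u} else ∅ := by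
      intro k
      have hv : ∀ v ∈ slicePoints W o I y k, v = u := fun v hv => by
        funext i
        exact_mod_cast (huniq k v hv i).trans (huniq m u hu i).symm
      split_ifs with hk
      · rw [hk] at hv ⊢
        exact Set.eq_singleton_iff_unique_mem.2 ⟨hu, hv⟩
      · rw [Set.eq_empty_iff_forall_notMem]
        intro v hvk
        refine hk ?_
        rw [← hvk.2.1, hv v hvk, hu.2.1]
    refine ⟨0, Polynomial.X ^ m, ?_, fun n hn => ?_⟩
    · ext k
      rw [pow_zero, mul_one, sliceSeries, PowerSeries.coeff_mk, hpoint, Polynomial.coeff_coe,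
        Polynomial.coeff_X_pow]
      split_ifs <;> simp
    · have hnm : n = m := by
        by_contra h
        exact hn (by rw [Polynomial.coeff_X_pow, if_neg h])
      rw [hnm, ← hu.2.1, huniq m u hu o]
      simpa using hb
  · push Not at hex
    have : sliceSeries W o I y = 0 := by
      ext k
      rw [sliceSeries, PowerSeries.coeff_mk, Set.eq_empty_iff_forall_notMem.2 (hex k)]
      simp
    rw [this]
    exact Submodule.zero_mem _

/-! ### Homogenization: from faces of the polytope to faces of the cone -/

section homogenization

variable {V : Type*} [NormedAddCommGroup V] [NormedSpace ℝ V] {N : ℕ}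

/-- The subspace `{(x, t) : ρ(x) = t λ}` of `ℝ^N × ℝ`. -/
def homogenization (Φ : Fin N → Module.Dual ℝ V) (lam : Module.Dual ℝ V) :
    Submodule ℝ (Option (Fin N) → ℝ) where
  carrier := {v | rho Φ (fun i => v (some i)) = v none • lam}
  zero_mem' := by
    have : rho Φ (fun _ => (0 : ℝ)) = 0 := map_zero (rho Φ)
    simp [this]
  add_mem' := by
    intro v w hv hw
    have : rho Φ (fun i => v (some i) + w (some i)) = _ :=
      map_add (rho Φ) (fun i => v (some i)) fun i => w (some i)
    simp only [Set.mem_ofPred_eq, Pi.add_apply] at hv hw ⊢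
    rw [this, hv, hw, add_smul]
  smul_mem' := by
    intro c v hv
    have : rho Φ (fun i => c * v (some i)) = _ := map_smul (rho Φ) c fun i => v (some i)
    simp only [Set.mem_ofPred_eq, Pi.smul_apply, smul_eq_mul] at hv ⊢
    rw [this, hv, mul_smul]

theorem mem_homogenization {Φ : Fin N → Module.Dual ℝ V} {lam : Module.Dual ℝ V}
    {v : Option (Fin N) → ℝ} :
    v ∈ homogenization Φ lam ↔ rho Φ (fun i => v (some i)) = v none • lam := Iff.rfl

theorem eq_zero_of_mem_homogenization {Φ : Fin N → Module.Dual ℝ V}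
    (hΦ : rho Φ ⁻¹' {0} ∩ orthant N = {0}) (lam : Module.Dual ℝ V) (v : Option (Fin N) → ℝ)
    (hv : v ∈ homogenization Φ lam) (h0 : ∀ i, 0 ≤ v i) (hn : v none = 0) : v = 0 := by
  rw [mem_homogenization, hn, zero_smul] at hv
  have h1 : (fun i => v (some i)) ∈ rho Φ ⁻¹' {0} ∩ orthant N := ⟨hv, fun i => h0 (some i)⟩
  rw [hΦ] at h1
  funext i
  cases i with
  | none => exact hn
  | some i => exact congrFun h1 i

/-- The point `(x, 1)`. -/
def atHeightOne (x : Fin N → ℝ) : Option (Fin N) → ℝ := fun i => i.elim 1 x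

@[simp] theorem atHeightOne_none (x : Fin N → ℝ) : atHeightOne x none = 1 := rfl

@[simp] theorem atHeightOne_some (x : Fin N → ℝ) (i : Fin N) : atHeightOne x (some i) = x i := rfl

/-- The face of the partition polytope where the coordinates in `I` vanish. -/
def polytopeFace (Φ : Fin N → Module.Dual ℝ V) (lam : Module.Dual ℝ V)
    (I : Finset (Option (Fin N))) : Set (Fin N → ℝ) :=
  {x | x ∈ polytope Φ lam ∧ ∀ i, some i ∈ I → x i = 0}

theorem atHeightOne_mem_coneFace {Φ : Fin N → Module.Dual ℝ V} {lam : Module.Dual ℝ V}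
    {I : Finset (Option (Fin N))} (hI : none ∉ I) {x : Fin N → ℝ} :
    atHeightOne x ∈ coneFace (homogenization Φ lam) I ↔ x ∈ polytopeFace Φ lam I := by
  constructor
  · rintro ⟨h1, h2, h3⟩
    refine ⟨⟨?_, fun i => h2 (some i)⟩, fun i hi => h3 (some i) hi⟩
    rw [mem_homogenization, atHeightOne_none, one_smul] at h1
    exact h1
  · rintro ⟨⟨h1, h2⟩, h3⟩
    refine ⟨?_, fun i => ?_, fun i hi => ?_⟩
    · rw [mem_homogenization, atHeightOne_none, one_smul]
      exact h1
    · cases i with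
      | none => exact zero_le_one
      | some i => exact h2 i
    · cases i with
      | none => exact absurd hi hI
      | some i => exact h3 i hi

theorem exists_smul_atHeightOne {Φ : Fin N → Module.Dual ℝ V}
    (hΦ : rho Φ ⁻¹' {0} ∩ orthant N = {0}) {lam : Module.Dual ℝ V}
    {I : Finset (Option (Fin N))} {v : Option (Fin N) → ℝ}
    (hv : v ∈ coneFace (homogenization Φ lam) I) (hv0 : v ≠ 0) :
    none ∉ I ∧ ∃ x ∈ polytopeFace Φ lam I, v = v none • atHeightOne x := by
  have hn : 0 < v none := lt_of_le_of_ne (hv.2.1 none) fun h =>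
    hv0 (eq_zero_of_mem_homogenization hΦ lam v hv.1 hv.2.1 h.symm)
  have hI : none ∉ I := fun h => hn.ne' (hv.2.2 none h)
  have hx : (v none)⁻¹ • v = atHeightOne fun i => (v none)⁻¹ * v (some i) := by
    funext i
    cases i with
    | none => simp [hn.ne']
    | some i => rfl
  refine ⟨hI, fun i => (v none)⁻¹ * v (some i), ?_, ?_⟩
  · rw [← atHeightOne_mem_coneFace hI, ← hx]
    exact smul_mem_coneFace hv (inv_nonneg.2 hn.le)
  · rw [← hx, smul_smul, mul_inv_cancel₀ hn.ne', one_smul]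

/-- The linear map `(x, t) ↦ x - t x₀`. -/
def projectFrom (x₀ : Fin N → ℝ) : (Option (Fin N) → ℝ) →ₗ[ℝ] (Fin N → ℝ) where
  toFun v := fun i => v (some i) - v none * x₀ i
  map_add' v w := by
    funext i
    simp only [Pi.add_apply]
    ring
  map_smul' c v := by
    funext i
    simp only [Pi.smul_apply, smul_eq_mul, RingHom.id_apply]
    ring

theorem projectFrom_atHeightOne (x₀ x : Fin N → ℝ) :
    projectFrom x₀ (atHeightOne x) = x - x₀ := by
  funext i
  simp [projectFrom]

theorem map_projectFrom_span {Φ : Fin N → Module.Dual ℝ V}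
    (hΦ : rho Φ ⁻¹' {0} ∩ orthant N = {0}) {lam : Module.Dual ℝ V}
    {I : Finset (Option (Fin N))} (hI : none ∉ I) {x₀ : Fin N → ℝ}
    (hx₀ : x₀ ∈ polytopeFace Φ lam I) :
    (Submodule.span ℝ (coneFace (homogenization Φ lam) I)).map (projectFrom x₀) =
      vectorSpan ℝ (polytopeFace Φ lam I) := by
  apply le_antisymm
  · rw [Submodule.map_span_le]
    intro v hv
    rcases eq_or_ne v 0 with rfl | hv0
    · rw [map_zero]; exact Submodule.zero_mem _
    · obtain ⟨-, x, hx, hvx⟩ := exists_smul_atHeightOne hΦ hv hv0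
      rw [hvx, map_smul, projectFrom_atHeightOne]
      exact Submodule.smul_mem _ _ (vsub_mem_vectorSpan ℝ hx hx₀)
  · rw [vectorSpan_eq_span_vsub_set_right ℝ hx₀, Submodule.span_le]
    rintro _ ⟨x, hx, rfl⟩
    exact ⟨atHeightOne x, Submodule.subset_span ((atHeightOne_mem_coneFace hI).2 hx),
      projectFrom_atHeightOne x₀ x⟩

/-- On the span of the cone face, `(x, t) ↦ x - t x₀` has image the direction of the polytope face
and kernel the line through `(x₀, 1)`. -/
theorem finrank_direction_add_one {Φ : Fin N → Module.Dual ℝ V}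
    (hΦ : rho Φ ⁻¹' {0} ∩ orthant N = {0}) {lam : Module.Dual ℝ V}
    {I : Finset (Option (Fin N))} (hI : none ∉ I) {x₀ : Fin N → ℝ}
    (hx₀ : x₀ ∈ polytopeFace Φ lam I) :
    Module.finrank ℝ (affineSpan ℝ (polytopeFace Φ lam I)).direction + 1 =
      Module.finrank ℝ (Submodule.span ℝ (coneFace (homogenization Φ lam) I)) := by
  set D := Submodule.span ℝ (coneFace (homogenization Φ lam) I) with hD
  have h1 := LinearMap.finrank_range_add_finrank_ker ((projectFrom x₀).domRestrict D)
  have hmem : atHeightOne x₀ ∈ D :=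
    Submodule.subset_span ((atHeightOne_mem_coneFace hI).2 hx₀)
  have hker : LinearMap.ker ((projectFrom x₀).domRestrict D) =
      Submodule.span ℝ {(⟨atHeightOne x₀, hmem⟩ : D)} := by
    ext v
    rw [LinearMap.mem_ker, Submodule.mem_span_singleton]
    constructor
    · intro h
      refine ⟨v.1 none, Subtype.ext (funext fun i => ?_)⟩
      cases i with
      | none => simp
      | some i =>
        have h2 : v.1 (some i) - v.1 none * x₀ i = 0 := congrFun h i
        simp only [SetLike.mk_smul_mk, Pi.smul_apply, atHeightOne_some, smul_eq_mul]
        linarith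
    · rintro ⟨c, rfl⟩
      rw [map_smul]
      have : (projectFrom x₀).domRestrict D ⟨atHeightOne x₀, hmem⟩ = 0 := by
        rw [LinearMap.domRestrict_apply, projectFrom_atHeightOne, sub_self]
      rw [this, smul_zero]
  rw [LinearMap.range_domRestrict, map_projectFrom_span hΦ hI hx₀, hker,
    finrank_span_singleton] at h1
  · rw [direction_affineSpan, h1]
  · intro h
    have := congrFun (congrArg Subtype.val h) none
    simp at this

theorem atHeightOne_mem_span {Φ : Fin N → Module.Dual ℝ V}
    (hΦ : rho Φ ⁻¹' {0} ∩ orthant N = {0}) {lam : Module.Dual ℝ V}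
    {I : Finset (Option (Fin N))} (hI : none ∉ I) {z : Fin N → ℝ}
    (hz : z ∈ affineSpan ℝ (polytopeFace Φ lam I)) :
    atHeightOne z ∈ Submodule.span ℝ (coneFace (homogenization Φ lam) I) := by
  obtain ⟨x₀, hx₀⟩ := (affineSpan_nonempty ℝ).1 ⟨z, hz⟩
  have h1 : z - x₀ ∈ vectorSpan ℝ (polytopeFace Φ lam I) := by
    rw [← direction_affineSpan]
    exact AffineSubspace.vsub_mem_direction hz (subset_affineSpan ℝ _ hx₀)
  rw [← map_projectFrom_span hΦ hI hx₀] at h1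
  obtain ⟨v, hv, hvz⟩ := h1
  have h2 : atHeightOne z = v + (1 - v none) • atHeightOne x₀ := by
    funext i
    cases i with
    | none => simp
    | some i =>
      have h3 : v (some i) - v none * x₀ i = z i - x₀ i := congrFun hvz i
      simp only [atHeightOne_some, Pi.add_apply, Pi.smul_apply, smul_eq_mul]
      linarith
  rw [h2]
  exact Submodule.add_mem _ hv (Submodule.smul_mem _ _
    (Submodule.subset_span ((atHeightOne_mem_coneFace hI).2 hx₀)))

/-- The form `-∑ i ∈ J, x i` is nonpositive on the orthant and vanishes exactly where all `x i`, `i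
∈ J`, do. -/
theorem isExposed_of_subset_orthant {S : Set (Fin N → ℝ)} (hS : S ⊆ orthant N)
    (J : Finset (Fin N)) : IsExposed ℝ S {x | x ∈ S ∧ ∀ i ∈ J, x i = 0} := by
  rintro ⟨x₀, hx₀, hx₀J⟩
  have hl : ∀ x : Fin N → ℝ,
      (-∑ i ∈ J, ContinuousLinearMap.proj (R := ℝ) (φ := fun _ : Fin N => ℝ) i) x =
        -∑ i ∈ J, x i := fun x => by
    rw [neg_apply, sum_apply]
    rfl
  refine ⟨-∑ i ∈ J, ContinuousLinearMap.proj i, Set.ext fun x => and_congr_right fun hx => ?_⟩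
  simp only [hl]
  constructor
  · intro h y hy
    rw [Finset.sum_eq_zero h, neg_zero]
    exact neg_nonpos.2 (Finset.sum_nonneg fun i _ => hS hy i)
  · intro h
    have h1 := h x₀ hx₀
    rw [Finset.sum_eq_zero hx₀J, neg_zero] at h1
    exact (Finset.sum_eq_zero_iff_of_nonneg fun i _ => hS hx i).1
      (le_antisymm (neg_nonneg.1 h1) (Finset.sum_nonneg fun i _ => hS hx i))

theorem isFaceOfDim_polytopeFace {Φ : Fin N → Module.Dual ℝ V}
    (hΦ : rho Φ ⁻¹' {0} ∩ orthant N = {0}) {lam : Module.Dual ℝ V}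
    {I : Finset (Option (Fin N))} {j : ℕ}
    (hj : Module.finrank ℝ (Submodule.span ℝ (coneFace (homogenization Φ lam) I)) = j + 1) :
    none ∉ I ∧ IsFaceOfDim (polytope Φ lam) (polytopeFace Φ lam I) j := by
  have hne : ∃ v ∈ coneFace (homogenization Φ lam) I, v ≠ 0 := by
    by_contra! h
    rw [Submodule.span_eq_bot.2 h, finrank_bot] at hj
    omega
  obtain ⟨v, hv, hv0⟩ := hne
  obtain ⟨hI, x, hx, -⟩ := exists_smul_atHeightOne hΦ hv hv0
  refine ⟨hI, ⟨x, hx⟩, ?_, ?_⟩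
  · have := isExposed_of_subset_orthant (S := polytope Φ lam) (fun _ h => h.2)
      (Finset.univ.filter fun i => some i ∈ I)
    simp only [Finset.mem_filter, Finset.mem_univ, true_and] at this
    exact this
  · have := finrank_direction_add_one hΦ hI hx
    omega

/-- A nonzero cone face contains a ray, that is, a face of dimension `1`. It meets height one in a
vertex `x` of the polytope, and `M x` is a lattice point by integrality. -/
theorem exists_vertex_multiple {Φ : Fin N → Module.Dual ℝ V}
    (hΦ : rho Φ ⁻¹' {0} ∩ orthant N = {0}) {lam : Module.Dual ℝ V} {M : ℕ} (hM : 0 < M)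
    (hint : IsIntegral ((M : ℝ) • polytope Φ lam)) (I : Finset (Option (Fin N)))
    (hI : ∃ v ∈ coneFace (homogenization Φ lam) I, v ≠ 0) :
    ∃ w : Option (Fin N) → ℕ,
      (fun i => (w i : ℝ)) ∈ coneFace (homogenization Φ lam) I ∧ w none = M := by
  have hpos : 0 + 1 ≤ Module.finrank ℝ
      (Submodule.span ℝ (coneFace (homogenization Φ lam) I)) := by
    rw [zero_add, Nat.one_le_iff_ne_zero]
    intro h
    obtain ⟨v, hv, hv0⟩ := hI
    rw [Submodule.finrank_eq_zero, Submodule.span_eq_bot] at h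
    exact hv0 (h v hv)
  obtain ⟨J, hIJ, hJ⟩ := exists_coneFace_of_finrank _ 0 I hpos
  obtain ⟨hnJ, ⟨x, hx⟩, -, hdim⟩ := isFaceOfDim_polytopeFace hΦ hJ
  rw [Submodule.finrank_eq_zero, direction_affineSpan] at hdim
  have huniq : ∀ y ∈ polytopeFace Φ lam J, y = x := fun y hy => by
    have := vsub_mem_vectorSpan ℝ hy hx
    rw [hdim, Submodule.mem_bot, vsub_eq_sub, sub_eq_zero] at this
    exact this
  have hM0 : (0 : ℝ) < M := Nat.cast_pos.2 hM
  have hset : {y | y ∈ (M : ℝ) • polytope Φ lam ∧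
      ∀ i ∈ Finset.univ.filter fun i => some i ∈ J, y i = 0} = {(M : ℝ) • x} := by
    ext y
    simp only [Set.mem_ofPred_eq, Finset.mem_filter, Finset.mem_univ, true_and,
      Set.mem_singleton_iff]
    constructor
    · rintro ⟨⟨y, hy, rfl⟩, h0⟩
      have : y ∈ polytopeFace Φ lam J := ⟨hy, fun i hi => by
        have h1 : (M : ℝ) * y i = 0 := h0 i hi
        exact (mul_eq_zero.1 h1).resolve_left hM0.ne'⟩
      simp only [huniq y this]
    · rintro rfl
      exact ⟨Set.smul_mem_smul_set hx.1, fun i hi => by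
        rw [Pi.smul_apply, hx.2 i hi, smul_zero]⟩
  have hface : IsFaceOfDim ((M : ℝ) • polytope Φ lam) {(M : ℝ) • x} 0 := by
    refine ⟨Set.singleton_nonempty _, ?_, ?_⟩
    · rw [← hset]
      refine isExposed_of_subset_orthant ?_ _
      rintro _ ⟨y, hy, rfl⟩ i
      exact mul_nonneg hM0.le (hy.2 i)
    · rw [direction_affineSpan, vectorSpan_singleton, finrank_bot]
  have hlat := hint _ hface (Set.mem_singleton _)
  choose m hm using hlat
  have hm0 : ∀ i, ((m i).toNat : ℝ) = M * x i := fun i => by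
    have h1 : (M : ℝ) * x i = m i := hm i
    have h2 : (0 : ℝ) ≤ m i := h1 ▸ mul_nonneg hM0.le (hx.1.2 i)
    have h3 : (0 : ℤ) ≤ m i := by exact_mod_cast h2
    rw [h1]
    exact_mod_cast Int.toNat_of_nonneg h3
  refine ⟨fun i => i.elim M fun i => (m i).toNat, ?_, rfl⟩
  have : (fun i : Option (Fin N) => ((i.elim M fun i => (m i).toNat : ℕ) : ℝ)) =
      (M : ℝ) • atHeightOne x := by
    funext i
    cases i with
    | none => simp
    | some i => exact hm0 i
  rw [this]
  exact coneFace_anti _ hIJ (smul_mem_coneFace ((atHeightOne_mem_coneFace hnJ).2 hx) hM0.le)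

theorem ehrhart_eq_ncard_slicePoints (Φ : Fin N → Module.Dual ℝ V) (lam : Module.Dual ℝ V)
    (k : ℕ) :
    ehrhart Φ lam k = (slicePoints (homogenization Φ lam) none ∅ 0 k).ncard := by
  symm
  refine Set.ncard_congr (fun u _ i => (u (some i) : ℝ)) ?_ ?_ ?_
  · rintro u ⟨hW, hk, -, -⟩
    rw [mem_homogenization, hk] at hW
    exact ⟨⟨hW, fun i => Nat.cast_nonneg _⟩, fun i => ⟨u (some i), by simp⟩⟩
  · rintro u v ⟨-, hu, -⟩ ⟨-, hv, -⟩ huv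
    funext i
    cases i with
    | none => rw [hu, hv]
    | some i => exact_mod_cast congrFun huv i
  · rintro x ⟨⟨hx, hx0⟩, hint⟩
    choose m hm using hint
    have hm0 : ∀ i, ((m i).toNat : ℝ) = x i := fun i => by
      have h2 : (0 : ℝ) ≤ m i := hm i ▸ hx0 i
      have h3 : (0 : ℤ) ≤ m i := by exact_mod_cast h2
      rw [hm i]
      exact_mod_cast Int.toNat_of_nonneg h3
    refine ⟨fun i => i.elim k fun i => (m i).toNat, ⟨?_, rfl, fun i => Nat.cast_nonneg _,
      fun i hi => absurd hi (Finset.notMem_empty i)⟩, funext hm0⟩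
    rw [mem_homogenization]
    simp only [Option.elim_some, Option.elim_none, hm0]
    exact hx

end homogenization

end PartitionPolytope

theorem mainTheorem9 {V : Type*} [NormedAddCommGroup V] [NormedSpace ℝ V]
    [FiniteDimensional ℝ V] (Γ : Submodule ℤ V) [DiscreteTopology Γ] [IsZLattice ℝ Γ]
    {N : ℕ} (Φ : Fin N → Module.Dual ℝ V)
    (hΦ_mem : ∀ i, Φ i ∈ PartitionPolytope.dualLattice Γ)
    (hΦ_span : Submodule.span ℝ (Set.range Φ) = ⊤)
    (hΦ_acute : PartitionPolytope.rho Φ ⁻¹' {0} ∩ PartitionPolytope.orthant N = {0})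
    (lam : Module.Dual ℝ V) (hlam_cone : lam ∈ PartitionPolytope.cone Φ)
    (hlam_int : lam ∈ Submodule.span ℤ (Set.range Φ))
    (M : ℕ) (hM : 0 < M)
    (hint : PartitionPolytope.IsIntegral ((M : ℝ) • PartitionPolytope.polytope Φ lam)) :
    ∃ P : ℂ → Polynomial ℂ,
      (∀ k : ℕ, (PartitionPolytope.ehrhart Φ lam k : ℂ) =
        ∑ ζ ∈ Polynomial.nthRootsFinset M (1 : ℂ), ζ ^ k * (P ζ).eval (k : ℂ)) ∧
      ∀ j : ℕ,
        (∀ f : Set (Fin N → ℝ),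
          PartitionPolytope.IsFaceOfDim (PartitionPolytope.polytope Φ lam) f j →
            PartitionPolytope.IsReticular f) →
        ∀ ζ : ℂ, ζ ^ M = 1 → ζ ≠ 1 → (P ζ).degree < (j : WithBot ℕ) := by
  open PartitionPolytope in
  have hpt := eq_zero_of_mem_homogenization hΦ_acute lam
  have hvert := exists_vertex_multiple hΦ_acute hM hint
  have hne : ∃ v ∈ coneFace (homogenization Φ lam) ∅, v ≠ 0 := by
    obtain ⟨x, hx, hxl⟩ := hlam_cone
    refine ⟨atHeightOne x, (atHeightOne_mem_coneFace (Finset.notMem_empty _)).2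
      ⟨⟨hxl, hx⟩, fun i hi => absurd hi (Finset.notMem_empty _)⟩, fun h => ?_⟩
    exact one_ne_zero (congrFun h none)
  have hF : sliceSeries (homogenization Φ lam) none ∅ 0 ∈ properSubmodule M 0 :=
    (sliceSeries_mem_properSubmodule hpt hM hvert ∅ (Submodule.zero_mem _) fun _ => le_rfl).2 hne
  obtain ⟨P, hP, hdeg⟩ := exists_quasiPolynomial_of_mem_properSubmodule hM hF
  refine ⟨P, fun k => ?_, fun j hret ζ hζ hζ1 => hdeg j ζ hζ ?_⟩
  · rw [← hP k, sliceSeries, PowerSeries.coeff_mk, ehrhart_eq_ncard_slicePoints]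
  -- The coefficients `ζ^k P_ζ(k)` come from the pole at `ζ⁻¹`.
  · have h := poleLE_sliceSeries_of_reticular (ζ := ζ⁻¹) (j := j) hpt hM hvert
      (by rw [inv_pow, hζ, inv_one]) (inv_ne_one.2 hζ1) (fun I hI => ?_) ∅ 0
    · simp only [Pi.zero_apply, Nat.cast_zero] at h
      exact h
    · obtain ⟨hnI, hface⟩ := isFaceOfDim_polytopeFace hΦ_acute hI
      obtain ⟨z, hz, hzf⟩ := hret _ hface
      choose m hm using hz
      refine ⟨fun i => i.elim 1 m, ?_, rfl⟩
      have : (fun i : Option (Fin N) => ((i.elim 1 m : ℤ) : ℝ)) = atHeightOne z := by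
        funext i
        cases i with
        | none => simp
        | some i => exact (hm i).symm
      rw [this]
      exact atHeightOne_mem_span hΦ_acute hnI hzf
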